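/- Throughout, scalars are real or complex. An \emph{Auerbach basis} of a Banach space $X$ is a system $\{x_i,x_i^*\}_{i\in I}\subset X\times X^*$ that is biorthogonal, whose vectors have dense linear span in $X$, whose functionals separate the points of $X$, and which satisfies $\|x_i\|=\|x_i^*\|=1$ for all $i$. A Schauder basis $(e_n)_{n\ge 0}$ is \emph{1-symmetric} if $\|\sum_n\theta_na_ne_{\pi(n)}\|=\|\sum_na_ne_n\|$ for all finitely supported scalars $(a_n)$, all signs $\theta_n=\pm1$ and all permutations $\pi$. The space $X$ has \emph{type 2} (respectively \emph{cotype 2}) if there is $C<\infty$ such that for all finite families $(x_i)$ in $X$ the mean of $\|\sum_i\varepsilon_ix_i\|$ over all choices of signs $\varepsilon_i=\pm1$ is at most $C(\sum_i\|x_i\|^2)^{1/2}$ (respectively at least $C^{-1}(\sum_i\|x_i\|^2)^{1/2}$). (a) Let $X$ be a Banach space with a 1-symmetric Schauder basis $(e_n)_{n\ge 0}$. Suppose that $X$ has type 2 or cotype 2, and that $X$ is not isomorphic to a Hilbert space. Then $X$ has an Auerbach basis, indexed by $\mathbb N$, that is not an unconditional Schauder basis of $X$. (b) If in (a) the scalars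 are complex, then such a basis is given by characters on cyclic blocks: for every strictly increasing sequence $(n_k)_{k\ge0}$ of positive integers, with $N_k=n_0+\dots+n_{k-1}$ and $$v_{k,\chi}=\sum_{l=0}^{n_k-1}\chi(l)\,e_{N_k+l},$$ the system of all vectors $v_{k,\chi}/\|v_{k,\chi}\|$, where $k\ge0$ and $\chi$ is a character of $\mathbb Z/n_k\mathbb Z$, is an Auerbach basis of $X$ (with suitable functionals), and it is not an unconditional Schauder basis of $X$. (c) In particular this covers Orlicz sequence spaces. Let $M$ be an Orlicz function, that is, $M:[0,\infty)\to[0,\infty)$ is continuous, nondecreasing and convex, $M(0)=0$, $M(t)>0$ for $t>0$, and $M(t)\to\infty$ as $t\to\infty$. Let $\ell_M$ be the space of scalar sequences $x$ with $\sum_i M(|x_i|/\rho)<\infty$ for some $\rho>0$, with the norm $\|x\|=\inf\{\rho>0:\sum_iM(|x_i|/\rho)\le1\}$. Suppose that $M$ satisfies the $\Delta_2$ condition at zero (there are $K$ and $t_0>0$ with $M(2t)\le KM(t)$ for $0<t\le t_0$), that the lower Matuszewska--Orlicz index $$\sup\Big\{q:\sup_{0<s,t\le1}\frac{M(st)}{M(s)t^q}<\infty\Big\}$$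 is at least $2$ or the upper Matuszewska--Orlicz index $$\inf\Big\{q:\inf_{0<s,t\le1}\frac{M(st)}{M(s)t^q}>0\Big\}$$ is at most $2$, and that $\ell_M$ is not isomorphic to a Hilbert space. Then $\ell_M$ has an Auerbach basis, indexed by $\mathbb N$, that is not an unconditional Schauder basis of $\ell_M$. If the scalars are complex, then for every strictly increasing sequence $(n_k)$ of positive integers the system in (b), formed with the unit vectors $(e_n)$ of $\ell_M$, is an Auerbach basis of $\ell_M$ that is not an unconditional Schauder basis. -/

import Mathlib

universe u v

noncomputable section

/-! ### Biorthogonal systems, Auerbach bases, unconditional bases -/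

/-- `{x i, f i}` is a Markushevich basis of `X`: a biorthogonal system in `X × X*` whose vectors
have dense linear span and whose functionals separate the points of `X`. -/
structure IsMarkushevichBasis {ι : Type*} (𝕜 : Type*) {X : Type*} [RCLike 𝕜]
    [NormedAddCommGroup X] [NormedSpace 𝕜 X] (x : ι → X) (f : ι → StrongDual 𝕜 X) : Prop where
  apply_self : ∀ i, f i (x i) = 1
  apply_ne : ∀ i j, i ≠ j → f i (x j) = 0
  fundamental : (Submodule.span 𝕜 (Set.range x)).topologicalClosure = ⊤
  total : ∀ y : X, (∀ i, f i y = 0) → y = 0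

/-- A Markushevich basis with `‖x i‖ = ‖f i‖ = 1` for all `i`. -/
structure IsAuerbachBasis {ι : Type*} (𝕜 : Type*) {X : Type*} [RCLike 𝕜]
    [NormedAddCommGroup X] [NormedSpace 𝕜 X] (x : ι → X) (f : ι → StrongDual 𝕜 X) : Prop
    extends IsMarkushevichBasis 𝕜 x f where
  norm_vector : ∀ i, ‖x i‖ = 1
  norm_functional : ∀ i, ‖f i‖ = 1

/-- The family `x` is an unconditional Schauder basis of `X`: it is biorthogonal to continuous
coordinate functionals, and every vector is the sum of its expansion along the net of all finite
sets of indices. -/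
def IsUnconditionalSchauderBasis {ι : Type*} (𝕜 : Type*) {X : Type*} [RCLike 𝕜]
    [NormedAddCommGroup X] [NormedSpace 𝕜 X] (x : ι → X) : Prop :=
  ∃ b : UnconditionalSchauderBasis ι 𝕜 X, b.basis = x

/-- The family `x`, together with some functionals, is an Auerbach basis of `X`, and it is not an
unconditional Schauder basis of `X`. -/
def IsNonUnconditionalAuerbach {ι : Type*} (𝕜 : Type*) {X : Type*} [RCLike 𝕜]
    [NormedAddCommGroup X] [NormedSpace 𝕜 X] (x : ι → X) : Prop :=
  (∃ f : ι → StrongDual 𝕜 X, IsAuerbachBasis 𝕜 x f) ∧ ¬ IsUnconditionalSchauderBasis 𝕜 x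

/-! ### 1-symmetric bases, type and cotype, Hilbert spaces up to isomorphism -/

/-- The Schauder basis `e` is 1-symmetric: permuting the basis vectors and changing signs of the
coefficients does not change the norm. -/
def IsOneSymmetric {𝕜 X : Type*} [RCLike 𝕜] [NormedAddCommGroup X] [NormedSpace 𝕜 X]
    (e : SchauderBasis 𝕜 X) : Prop :=
  ∀ (s : Finset ℕ) (a : ℕ → 𝕜) (θ : ℕ → ℤˣ) (π : Equiv.Perm ℕ),
    ‖∑ i ∈ s, (θ i : ℤ) • a i • e.basis (π i)‖ = ‖∑ i ∈ s, a i • e.basis i‖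

/-- `∫₀¹ ‖∑ rᵢ(t) xᵢ‖ dt` for the Rademacher functions `rᵢ`, that is, the mean of `‖∑ εᵢ xᵢ‖`
over all choices of signs. -/
def rademacherAverage {X : Type*} [NormedAddCommGroup X] {m : ℕ} (x : Fin m → X) : ℝ :=
  (∑ ε : Fin m → ℤˣ, ‖∑ i, (ε i : ℤ) • x i‖) / 2 ^ m

/-- `X` has (Rademacher) type 2. -/
def HasTypeTwo (X : Type*) [NormedAddCommGroup X] : Prop :=
  ∃ C : ℝ, ∀ (m : ℕ) (x : Fin m → X), rademacherAverage x ≤ C * √(∑ i, ‖x i‖ ^ 2)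

/-- `X` has (Rademacher) cotype 2. -/
def HasCotypeTwo (X : Type*) [NormedAddCommGroup X] : Prop :=
  ∃ C : ℝ, ∀ (m : ℕ) (x : Fin m → X), √(∑ i, ‖x i‖ ^ 2) ≤ C * rademacherAverage x

/-- `X` is isomorphic (linearly homeomorphic) to a Hilbert space. -/
def IsIsomorphicToHilbert (𝕜 : Type u) (X : Type v) [RCLike 𝕜] [NormedAddCommGroup X]
    [NormedSpace 𝕜 X] : Prop :=
  ∃ H : Type v, ∃ (_ : NormedAddCommGroup H) (_ : InnerProductSpace 𝕜 H) (_ : CompleteSpace H),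
    Nonempty (X ≃L[𝕜] H)

/-! ### Characters on cyclic blocks -/

/-- The vector of the block `{N, …, N + n k - 1}`, `N = n 0 + ⋯ + n (k-1)`, of `e`, whose
coordinates are the values of the character `χ` of `ℤ / n k`. -/
def characterVector {X : Type*} [NormedAddCommGroup X] [NormedSpace ℂ X] (e : ℕ → X) (n : ℕ → ℕ)
    (p : Σ k : ℕ, AddChar (ZMod (n k)) ℂ) : X :=
  ∑ l ∈ Finset.range (n p.1), p.2 (l : ZMod (n p.1)) • e ((∑ i ∈ Finset.range p.1, n i) + l)

/-- The system of all characters of the cyclic groups `ℤ / n k`, placed on the consecutive blocks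
of `e` of lengths `n k`, and normalized in `X`. -/
def characterSystem {X : Type*} [NormedAddCommGroup X] [NormedSpace ℂ X] (e : ℕ → X) (n : ℕ → ℕ)
    (p : Σ k : ℕ, AddChar (ZMod (n k)) ℂ) : X :=
  ((‖characterVector e n p‖⁻¹ : ℝ) : ℂ) • characterVector e n p

/-! ### Orlicz functions and Orlicz sequence spaces -/

/-- A (nondegenerate) Orlicz function; only its values on `[0, ∞)` matter. -/
structure OrliczFunction where
  toFun : ℝ → ℝ
  map_zero : toFun 0 = 0
  pos : ∀ t, 0 < t → 0 < toFun t
  mono : MonotoneOn toFun (Set.Ici 0)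
  cont : ContinuousOn toFun (Set.Ici 0)
  convex : ConvexOn ℝ (Set.Ici 0) toFun
  unbounded : Filter.Tendsto toFun Filter.atTop Filter.atTop

namespace OrliczFunction

/-- The `Δ₂` condition at zero. -/
def DeltaTwoAtZero (M : OrliczFunction) : Prop :=
  ∃ K t₀ : ℝ, 0 < t₀ ∧ ∀ t, 0 < t → t ≤ t₀ → M.toFun (2 * t) ≤ K * M.toFun t

/-- The lower Matuszewska-Orlicz index of `M` at zero,
`sup {q : sup_{0 < s, t ≤ 1} M(s t) / (M(s) t ^ q) < ∞}`. -/
def lowerIndex (M : OrliczFunction) : EReal :=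
  sSup {r : EReal | ∃ q : ℝ, r = (q : EReal) ∧ ∃ C : ℝ, ∀ s t : ℝ, 0 < s → s ≤ 1 → 0 < t →
    t ≤ 1 → M.toFun (s * t) / (M.toFun s * t ^ q) ≤ C}

/-- The upper Matuszewska-Orlicz index of `M` at zero,
`inf {q : inf_{0 < s, t ≤ 1} M(s t) / (M(s) t ^ q) > 0}`. -/
def upperIndex (M : OrliczFunction) : EReal :=
  sInf {r : EReal | ∃ q : ℝ, r = (q : EReal) ∧ ∃ c : ℝ, 0 < c ∧ ∀ s t : ℝ, 0 < s → s ≤ 1 →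
    0 < t → t ≤ 1 → c ≤ M.toFun (s * t) / (M.toFun s * t ^ q)}

variable {𝕜 : Type*} [RCLike 𝕜]

theorem nonneg (M : OrliczFunction) {t : ℝ} (ht : 0 ≤ t) : 0 ≤ M.toFun t := by
  rcases ht.eq_or_lt with h | h
  · rw [← h, M.map_zero]
  · exact (M.pos t h).le

theorem scale_le (M : OrliczFunction) {t c : ℝ} (ht : 0 ≤ t) (hc : 0 ≤ c) (hc1 : c ≤ 1) :
    M.toFun (c * t) ≤ c * M.toFun t := by
  have h := M.convex.2 (Set.mem_Ici.2 ht) (Set.mem_Ici.2 le_rfl) hc (sub_nonneg.2 hc1) (by ring)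
  simpa [M.map_zero] using h

/-- `x` lies in `ρ` times the modular unit ball: `∑ M(|x i| / ρ) ≤ 1`. -/
def Admissible (M : OrliczFunction) (x : ℕ → 𝕜) (ρ : ℝ) : Prop :=
  0 < ρ ∧ Summable (fun i => M.toFun (‖x i‖ / ρ)) ∧ ∑' i, M.toFun (‖x i‖ / ρ) ≤ 1

theorem admissible_iff (M : OrliczFunction) (x : ℕ → 𝕜) (ρ : ℝ) :
    M.Admissible x ρ ↔ 0 < ρ ∧ ∀ s : Finset ℕ, ∑ i ∈ s, M.toFun (‖x i‖ / ρ) ≤ 1 := by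
  constructor
  · rintro ⟨h0, hs, h1⟩
    refine ⟨h0, fun s => (hs.sum_le_tsum s fun i _ => M.nonneg (by positivity)).trans h1⟩
  · rintro ⟨h0, h⟩
    have hn : ∀ i, 0 ≤ M.toFun (‖x i‖ / ρ) := fun i => M.nonneg (by positivity)
    have hs : Summable (fun i => M.toFun (‖x i‖ / ρ)) := summable_of_sum_le hn h
    exact ⟨h0, hs, hs.tsum_le_of_sum_le h⟩

theorem exists_admissible (M : OrliczFunction) (x : ℕ → 𝕜)
    (h : ∃ ρ : ℝ, 0 < ρ ∧ Summable (fun i => M.toFun (‖x i‖ / ρ))) :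
    ∃ ρ, M.Admissible x ρ := by
  obtain ⟨ρ, h0, hs⟩ := h
  have hn : ∀ i, 0 ≤ M.toFun (‖x i‖ / ρ) := fun i => M.nonneg (by positivity)
  set S := ∑' i, M.toFun (‖x i‖ / ρ) with hS
  have hS0 : 0 ≤ S := tsum_nonneg hn
  refine ⟨(S + 1) * ρ, (M.admissible_iff x _).2 ⟨by positivity, fun s => ?_⟩⟩
  have hle : ∀ i, M.toFun (‖x i‖ / ((S + 1) * ρ)) ≤ (S + 1)⁻¹ * M.toFun (‖x i‖ / ρ) := by
    intro i
    have e : ‖x i‖ / ((S + 1) * ρ) = (S + 1)⁻¹ * (‖x i‖ / ρ) := by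
      field_simp
    rw [e]
    exact M.scale_le (by positivity) (by positivity) (inv_le_one_of_one_le₀ (by linarith))
  calc ∑ i ∈ s, M.toFun (‖x i‖ / ((S + 1) * ρ))
      ≤ ∑ i ∈ s, (S + 1)⁻¹ * M.toFun (‖x i‖ / ρ) := Finset.sum_le_sum fun i _ => hle i
    _ = (S + 1)⁻¹ * ∑ i ∈ s, M.toFun (‖x i‖ / ρ) := by rw [Finset.mul_sum]
    _ ≤ (S + 1)⁻¹ * S := by
        gcongr
        exact hs.sum_le_tsum s fun i _ => hn i
    _ ≤ 1 := by
        rw [inv_mul_le_iff₀ (by positivity)]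
        linarith

theorem Admissible.add {M : OrliczFunction} {x y : ℕ → 𝕜} {a b : ℝ} (hx : M.Admissible x a)
    (hy : M.Admissible y b) : M.Admissible (x + y) (a + b) := by
  rw [admissible_iff] at *
  obtain ⟨ha, hx⟩ := hx
  obtain ⟨hb, hy⟩ := hy
  refine ⟨by positivity, fun s => ?_⟩
  have hle : ∀ i, M.toFun (‖(x + y) i‖ / (a + b)) ≤
      a / (a + b) * M.toFun (‖x i‖ / a) + b / (a + b) * M.toFun (‖y i‖ / b) := by
    intro i
    have h1 : ‖(x + y) i‖ / (a + b) ≤ a / (a + b) * (‖x i‖ / a) + b / (a + b) * (‖y i‖ / b) := by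
      have e : a / (a + b) * (‖x i‖ / a) + b / (a + b) * (‖y i‖ / b) =
          (‖x i‖ + ‖y i‖) / (a + b) := by
        field_simp
      rw [e]
      gcongr
      exact norm_add_le _ _
    refine (M.mono (Set.mem_Ici.2 (by positivity)) (Set.mem_Ici.2 (by positivity)) h1).trans ?_
    have h2 := M.convex.2 (Set.mem_Ici.2 (by positivity : 0 ≤ ‖x i‖ / a))
      (Set.mem_Ici.2 (by positivity : 0 ≤ ‖y i‖ / b)) (by positivity : 0 ≤ a / (a + b))
      (by positivity : 0 ≤ b / (a + b)) (by field_simp)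
    simpa using h2
  calc ∑ i ∈ s, M.toFun (‖(x + y) i‖ / (a + b))
      ≤ ∑ i ∈ s, (a / (a + b) * M.toFun (‖x i‖ / a) + b / (a + b) * M.toFun (‖y i‖ / b)) :=
        Finset.sum_le_sum fun i _ => hle i
    _ = a / (a + b) * ∑ i ∈ s, M.toFun (‖x i‖ / a)
        + b / (a + b) * ∑ i ∈ s, M.toFun (‖y i‖ / b) := by
        rw [Finset.sum_add_distrib, Finset.mul_sum, Finset.mul_sum]
    _ ≤ a / (a + b) * 1 + b / (a + b) * 1 := by
        gcongr
        · exact hx s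
        · exact hy s
    _ = 1 := by field_simp

theorem Admissible.smul {M : OrliczFunction} {x : ℕ → 𝕜} {a : ℝ} (hx : M.Admissible x a) {c : 𝕜}
    (hc : c ≠ 0) : M.Admissible (c • x) (‖c‖ * a) := by
  have hc' : 0 < ‖c‖ := norm_pos_iff.2 hc
  have e : ∀ i, ‖(c • x) i‖ / (‖c‖ * a) = ‖x i‖ / a := by
    intro i
    simp only [Pi.smul_apply, smul_eq_mul, norm_mul]
    exact mul_div_mul_left _ _ hc'.ne'
  exact ⟨mul_pos hc' hx.1, by simpa only [e] using hx.2.1, by simpa only [e] using hx.2.2⟩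

theorem admissible_zero (M : OrliczFunction) {a : ℝ} (ha : 0 < a) :
    M.Admissible (0 : ℕ → 𝕜) a := by
  rw [admissible_iff]
  exact ⟨ha, fun s => by simp [M.map_zero]⟩

/-- The sequences `x` with `∑ M(|x i| / ρ) < ∞` for some `ρ > 0`. -/
def submodule (𝕜 : Type*) [RCLike 𝕜] (M : OrliczFunction) : Submodule 𝕜 (ℕ → 𝕜) where
  carrier := {x | ∃ ρ : ℝ, 0 < ρ ∧ Summable (fun i => M.toFun (‖x i‖ / ρ))}
  add_mem' := by
    intro x y hx hy
    obtain ⟨a, ha⟩ := M.exists_admissible x hx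
    obtain ⟨b, hb⟩ := M.exists_admissible y hy
    exact ⟨a + b, (ha.add hb).1, (ha.add hb).2.1⟩
  zero_mem' := ⟨1, one_pos, (M.admissible_zero one_pos).2.1⟩
  smul_mem' := by
    intro c x hx
    obtain ⟨a, ha⟩ := M.exists_admissible x hx
    rcases eq_or_ne c 0 with rfl | hc
    · rw [zero_smul]
      exact ⟨1, one_pos, (M.admissible_zero one_pos).2.1⟩
    · exact ⟨_, (ha.smul hc).1, (ha.smul hc).2.1⟩

end OrliczFunction

/-- The Orlicz sequence space `ℓ_M` over `𝕜`. -/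
def OrliczSpace (𝕜 : Type*) [RCLike 𝕜] (M : OrliczFunction) : Type _ :=
  M.submodule 𝕜

namespace OrliczSpace

variable {𝕜 : Type*} [RCLike 𝕜] {M : OrliczFunction}

instance : AddCommGroup (OrliczSpace 𝕜 M) := inferInstanceAs (AddCommGroup (M.submodule 𝕜))

instance : Module 𝕜 (OrliczSpace 𝕜 M) := inferInstanceAs (Module 𝕜 (M.submodule 𝕜))

/-- The sequence underlying an element of `ℓ_M`, as a linear map. -/
def coords : OrliczSpace 𝕜 M →ₗ[𝕜] (ℕ → 𝕜) := (M.submodule 𝕜).subtype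

theorem coords_injective : Function.Injective (coords : OrliczSpace 𝕜 M → ℕ → 𝕜) :=
  Subtype.coe_injective

/-- The Luxemburg norm `inf {ρ > 0 : ∑ M(|x i| / ρ) ≤ 1}`. -/
instance : Norm (OrliczSpace 𝕜 M) := ⟨fun x => sInf {ρ | M.Admissible (coords x) ρ}⟩

theorem norm_def (x : OrliczSpace 𝕜 M) : ‖x‖ = sInf {ρ | M.Admissible (coords x) ρ} := rfl

theorem admissible_nonempty (x : OrliczSpace 𝕜 M) : {ρ | M.Admissible (coords x) ρ}.Nonempty :=
  M.exists_admissible (coords x) x.2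

theorem norm_le {x : OrliczSpace 𝕜 M} {ρ : ℝ} (h : M.Admissible (coords x) ρ) : ‖x‖ ≤ ρ :=
  csInf_le ⟨0, fun _ h => h.1.le⟩ h

theorem exists_lt {x : OrliczSpace 𝕜 M} {r : ℝ} (h : ‖x‖ < r) :
    ∃ ρ, M.Admissible (coords x) ρ ∧ ρ < r :=
  exists_lt_of_csInf_lt (admissible_nonempty x) h

theorem norm_nonneg_aux (x : OrliczSpace 𝕜 M) : 0 ≤ ‖x‖ :=
  Real.sInf_nonneg fun _ h => h.1.le

theorem norm_zero_aux : ‖(0 : OrliczSpace 𝕜 M)‖ = 0 := by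
  refine le_antisymm (le_of_forall_pos_le_add fun r hr => ?_) (norm_nonneg_aux _)
  rw [zero_add]
  refine norm_le ?_
  rw [_root_.map_zero]
  exact M.admissible_zero hr

theorem norm_smul_le_aux (c : 𝕜) (x : OrliczSpace 𝕜 M) : ‖c • x‖ ≤ ‖c‖ * ‖x‖ := by
  rcases eq_or_ne c 0 with rfl | hc
  · rw [zero_smul, norm_zero_aux, _root_.norm_zero, zero_mul]
  · have hc' : 0 < ‖c‖ := norm_pos_iff.2 hc
    rw [← div_le_iff₀' hc']
    refine le_csInf (admissible_nonempty x) fun ρ h => ?_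
    rw [div_le_iff₀' hc']
    refine norm_le ?_
    rw [_root_.map_smul]
    exact h.smul hc

theorem core : NormedSpace.Core 𝕜 (OrliczSpace 𝕜 M) where
  norm_nonneg := norm_nonneg_aux
  norm_smul c x := by
    refine le_antisymm (norm_smul_le_aux c x) ?_
    rcases eq_or_ne c 0 with rfl | hc
    · rw [_root_.norm_zero, zero_mul]
      exact norm_nonneg_aux _
    · have hc' : 0 < ‖c‖ := norm_pos_iff.2 hc
      have h := norm_smul_le_aux c⁻¹ (c • x)
      rw [smul_smul, inv_mul_cancel₀ hc, one_smul, norm_inv] at h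
      rwa [← le_inv_mul_iff₀ hc']
  norm_triangle x y := by
    refine le_of_forall_pos_le_add fun r hr => ?_
    obtain ⟨a, ha, ha'⟩ := exists_lt (x := x) (r := ‖x‖ + r / 2) (by linarith)
    obtain ⟨b, hb, hb'⟩ := exists_lt (x := y) (r := ‖y‖ + r / 2) (by linarith)
    have h : ‖x + y‖ ≤ a + b := norm_le (by rw [_root_.map_add]; exact ha.add hb)
    linarith
  norm_eq_zero_iff x := by
    refine ⟨fun h => ?_, fun h => by rw [h, norm_zero_aux]⟩
    apply coords_injective
    rw [_root_.map_zero]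
    funext i
    by_contra hi
    have hi' : 0 < ‖coords x i‖ := norm_pos_iff.2 hi
    obtain ⟨T, hT, hT0⟩ := ((M.unbounded.eventually_gt_atTop 1).and
      (Filter.eventually_gt_atTop 0)).exists
    obtain ⟨ρ, hρ, hlt⟩ := exists_lt (x := x) (r := ‖coords x i‖ / T)
      (by rw [h]; positivity)
    have h1 := ((M.admissible_iff _ _).1 hρ).2 {i}
    rw [Finset.sum_singleton] at h1
    have h2 : T ≤ ‖coords x i‖ / ρ := by
      rw [le_div_iff₀ hρ.1]
      rw [lt_div_iff₀ hT0] at hlt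
      linarith
    have h3 := M.mono (Set.mem_Ici.2 hT0.le) (Set.mem_Ici.2 (hT0.le.trans h2)) h2
    linarith

instance : NormedAddCommGroup (OrliczSpace 𝕜 M) := NormedAddCommGroup.ofCore core

instance : NormedSpace 𝕜 (OrliczSpace 𝕜 M) := NormedSpace.ofCore core

variable (𝕜 M) in
/-- The `i`-th unit vector of `ℓ_M`. -/
def unitVector (i : ℕ) : OrliczSpace 𝕜 M :=
  ⟨Pi.single i 1, 1, one_pos, by
    refine summable_of_ne_finset_zero (s := {i}) fun j hj => ?_
    rw [Pi.single_eq_of_ne (by simpa using hj)]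
    simp [M.map_zero]⟩

end OrliczSpace

end

/-! Cut the basis into blocks indexed by finite abelian groups `G` of unbounded order, and replace
the unit vectors of each block by the characters of its group. The projection onto a character is a
mean of translations with unimodular weights. Translations permute the basis, hence are isometries,
so these projections are contractive and the normalized characters form an Auerbach basis in every
space with a 1-symmetric basis. Walsh functions serve real and complex scalars alike; characters of
cyclic groups serve complex scalars.

Suppose this system were unconditional. Then on every block the signs of the Fourier coefficients of
a vector `a` can be changed at a bounded cost. With `n = |G|` and `s` the root mean square of `a`,
random signs turn `a` into a `y` with the same root mean square whose values are exponentially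
integrable at scale `s` (`exists_flat`). Such a `y` is flat: its mean modulus is comparable with
`s`, so averaging over translations gives a lower bound `‖y‖ ≥ c s λ(n)`, where `λ(n)` is the norm
of the sum of `n` basis vectors. Hence `‖a‖ ≥ c ‖a‖₂ λ(n) / √n` on every block
(`l2_mul_fundamental_le`).

A matching upper bound makes the basis equivalent to that of `ℓ₂`, against the assumption that `X`
is not Hilbertian. It comes from one of two sources. If flat vectors also satisfy `‖y‖ ≤ B s λ(n)`
(`FlatBound`), the norm on each block is proportional to the `ℓ₂` norm up to constants, and a single
basis vector shows that `λ(n) / √n` is bounded above and below. Cotype 2 gives this bound through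
the growth of `λ` (`flatBound_of_hasCotypeTwo`); for Orlicz spaces it follows from the polynomial
growth of `M` (`flatBound_unitBasis`). If `X` has type 2, the upper `ℓ₂` estimate is immediate, and
expanding a basis vector into characters bounds `λ(n) / √n` from below. -/

noncomputable section

section

/-! ### Norms of finite sums along a 1-symmetric basis -/

namespace IsOneSymmetric

variable {𝕜 X : Type*} [RCLike 𝕜] [NormedAddCommGroup X] [NormedSpace 𝕜 X]

/-- The sum `∑ a i • e (ψ i)` over a finite type. -/
def blockSum {ι : Type*} [Fintype ι] (e : SchauderBasis 𝕜 X) (ψ : ι → ℕ) (a : ι → 𝕜) : X :=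
  ∑ i, a i • e.basis (ψ i)

variable {ι κ : Type*} [Fintype ι] [Fintype κ] {e : SchauderBasis 𝕜 X}

theorem blockSum_add (ψ : ι → ℕ) (a b : ι → 𝕜) :
    blockSum e ψ (a + b) = blockSum e ψ a + blockSum e ψ b := by
  simp [blockSum, add_smul, Finset.sum_add_distrib]

theorem blockSum_smul (ψ : ι → ℕ) (c : 𝕜) (a : ι → 𝕜) :
    blockSum e ψ (c • a) = c • blockSum e ψ a := by
  simp [blockSum, Finset.smul_sum, mul_smul]

theorem blockSum_sum {J : Type*} (s : Finset J) (ψ : ι → ℕ) (a : J → ι → 𝕜) :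
    blockSum e ψ (∑ j ∈ s, a j) = ∑ j ∈ s, blockSum e ψ (a j) := by
  simp only [blockSum, Finset.sum_apply, Finset.sum_smul]
  exact Finset.sum_comm

theorem blockSum_single [DecidableEq ι] (ψ : ι → ℕ) (i : ι) :
    blockSum e ψ (Pi.single i (1 : 𝕜)) = e.basis (ψ i) := by
  simp [blockSum, Pi.single_apply]

theorem coord_blockSum {ψ : ι → ℕ} (hψ : Function.Injective ψ) (a : ι → 𝕜) (i : ι) :
    e.coord (ψ i) (blockSum e ψ a) = a i := by
  classical
  simp [blockSum, e.ortho, Pi.single_apply, hψ.eq_iff]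

theorem blockSum_comp_equiv (σ : κ ≃ ι) (ψ : ι → ℕ) (a : ι → 𝕜) :
    blockSum e (ψ ∘ σ) (a ∘ σ) = blockSum e ψ a :=
  σ.sum_comp fun i => a i • e.basis (ψ i)

theorem blockSum_extend {f : κ → ι} (hf : Function.Injective f) (ψ : ι → ℕ) (a : κ → 𝕜) :
    blockSum e ψ (Function.extend f a 0) = blockSum e (ψ ∘ f) a := by
  classical
  simp only [blockSum]
  rw [← Finset.sum_subset (Finset.subset_univ (Finset.univ.image f)),
    Finset.sum_image hf.injOn]
  · simp [hf.extend_apply]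
  · intro i _ hi
    rw [Function.extend_apply', Pi.zero_apply, zero_smul]
    rintro ⟨j, rfl⟩
    exact hi (Finset.mem_image_of_mem f (Finset.mem_univ j))

theorem norm_basis_sum_perm_units (he : IsOneSymmetric e) {ψ : ι → ℕ}
    (hψ : Function.Injective ψ) (π : Equiv.Perm ℕ) (a : ι → 𝕜) (θ : ι → ℤˣ) :
    ‖blockSum e (π ∘ ψ) (fun i => ((θ i : ℤ) : 𝕜) * a i)‖ = ‖blockSum e ψ a‖ := by
  classical
  have h := he (Finset.univ.image ψ) (Function.extend ψ a 0) (Function.extend ψ θ 1) π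
  rw [Finset.sum_image hψ.injOn, Finset.sum_image hψ.injOn] at h
  simpa [hψ.extend_apply, blockSum, mul_smul, ← Int.cast_smul_eq_zsmul 𝕜] using h

theorem norm_blockSum_units (he : IsOneSymmetric e) {ψ : ι → ℕ}
    (hψ : Function.Injective ψ) (a : ι → 𝕜) (θ : ι → ℤˣ) :
    ‖blockSum e ψ (fun i => ((θ i : ℤ) : 𝕜) * a i)‖ = ‖blockSum e ψ a‖ :=
  he.norm_basis_sum_perm_units hψ 1 a θ

/-- Two injections of a finite set into `ℕ` differ by a permutation of `ℕ`, so the norm depends on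
the coefficients only. This lets all blocks be moved to an initial segment. -/
theorem norm_blockSum_congr (he : IsOneSymmetric e) {ψ ψ' : ι → ℕ}
    (hψ : Function.Injective ψ) (hψ' : Function.Injective ψ') (a : ι → 𝕜) :
    ‖blockSum e ψ a‖ = ‖blockSum e ψ' a‖ := by
  obtain ⟨π, hπ⟩ := Equiv.Perm.exists_extending_pair ψ' ψ hψ' hψ
  have h := he.norm_basis_sum_perm_units hψ' π a 1
  have hc : π ∘ ψ' = ψ := funext fun i => hπ i
  rw [hc] at h
  simpa using h

theorem norm_blockSum_comp (he : IsOneSymmetric e) {ψ : ι → ℕ} {ψ' : κ → ℕ}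
    (hψ : Function.Injective ψ) (hψ' : Function.Injective ψ') (σ : κ ≃ ι) (a : ι → 𝕜) :
    ‖blockSum e ψ' (a ∘ σ)‖ = ‖blockSum e ψ a‖ := by
  rw [← blockSum_comp_equiv σ ψ a]
  exact he.norm_blockSum_congr hψ' (hψ.comp σ.injective) _

theorem norm_basis_eq (he : IsOneSymmetric e) (i j : ℕ) : ‖e.basis i‖ = ‖e.basis j‖ := by
  have h := he.norm_blockSum_congr (ι := Unit) (ψ := fun _ => i) (ψ' := fun _ => j)
    (Function.injective_of_subsingleton _) (Function.injective_of_subsingleton _) 1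
  simpa [blockSum] using h

theorem _root_.SchauderBasis.norm_basis_pos (e : SchauderBasis 𝕜 X) (i : ℕ) :
    0 < ‖e.basis i‖ := by
  rw [norm_pos_iff]
  intro h
  have := e.ortho i i
  simp [h] at this

/-- Multiplying the coefficients by reals in `[-1, 1]` does not increase the norm. -/
theorem norm_blockSum_mul_real_le (he : IsOneSymmetric e) {ψ : ι → ℕ}
    (hψ : Function.Injective ψ) (a : ι → 𝕜) (m : ι → ℝ) (hm : ∀ i, |m i| ≤ 1) :
    ‖blockSum e ψ (fun i => (m i : 𝕜) * a i)‖ ≤ ‖blockSum e ψ a‖ := by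
  classical
  -- change the coefficients one at a time
  suffices H : ∀ s : Finset ι,
      ‖blockSum e ψ (fun i => if i ∈ s then (m i : 𝕜) * a i else a i)‖ ≤ ‖blockSum e ψ a‖ by
    simpa using H Finset.univ
  intro s
  induction s using Finset.induction_on with
  | empty => simp
  | insert j s hj ih =>
    refine le_trans ?_ ih
    set b : ι → 𝕜 := fun i => if i ∈ s then (m i : 𝕜) * a i else a i with hb
    have hflip := he.norm_blockSum_units hψ b (fun i => if i = j then -1 else 1)
    set b' : ι → 𝕜 := fun i => (((if i = j then -1 else 1 : ℤˣ) : ℤ) : 𝕜) * b i with hb'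
    -- Multiplying coordinate `j` by `m j ∈ [-1, 1]` is a convex combination of the identity and the
    -- sign flip at `j`, both isometric.
    have hconv : (fun i => if i ∈ insert j s then (m i : 𝕜) * a i else a i) =
        (((1 + m j) / 2 : ℝ) : 𝕜) • b + (((1 - m j) / 2 : ℝ) : 𝕜) • b' := by
      have hp : (((1 + m j) / 2 : ℝ) : 𝕜) + (((1 - m j) / 2 : ℝ) : 𝕜) = 1 := by
        rw [← RCLike.ofReal_add, show (1 + m j) / 2 + (1 - m j) / 2 = 1 by ring,
          RCLike.ofReal_one]
      have hq : (((1 + m j) / 2 : ℝ) : 𝕜) - (((1 - m j) / 2 : ℝ) : 𝕜) = m j := by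
        rw [← RCLike.ofReal_sub]
        congr 1
        ring
      generalize (((1 + m j) / 2 : ℝ) : 𝕜) = p at hp hq ⊢
      generalize (((1 - m j) / 2 : ℝ) : 𝕜) = q at hp hq ⊢
      funext i
      by_cases hij : i = j
      · subst hij
        simp only [Finset.mem_insert, true_or, if_true, hb, hb', hj, if_false, Pi.add_apply,
          Pi.smul_apply, smul_eq_mul, Units.val_neg, Units.val_one, Int.cast_neg, Int.cast_one]
        rw [← hq]
        ring
      · simp only [Finset.mem_insert, hij, false_or, hb, hb', Pi.add_apply, Pi.smul_apply,
          smul_eq_mul, if_false, Units.val_one, Int.cast_one, one_mul]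
        rw [← add_mul, hp, one_mul]
    have h1 := abs_le.1 (hm j)
    rw [hconv, blockSum_add, blockSum_smul, blockSum_smul]
    refine (norm_add_le _ _).trans ?_
    rw [norm_smul, norm_smul, hflip, RCLike.norm_ofReal, RCLike.norm_ofReal,
      abs_of_nonneg (by linarith), abs_of_nonneg (by linarith)]
    exact le_of_eq (by ring)

/-- A 1-symmetric basis is a lattice basis up to the factor `2`. -/
theorem norm_blockSum_le_two_mul (he : IsOneSymmetric e) {ψ : ι → ℕ}
    (hψ : Function.Injective ψ) {a b : ι → 𝕜} (hab : ∀ i, ‖a i‖ ≤ ‖b i‖) :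
    ‖blockSum e ψ a‖ ≤ 2 * ‖blockSum e ψ b‖ := by
  set c : ι → 𝕜 := fun i => a i / b i
  have hc : ∀ i, ‖c i‖ ≤ 1 := fun i => by
    rw [norm_div]
    exact div_le_one_of_le₀ (hab i) (norm_nonneg _)
  -- Symmetry provides only the signs `±1`, so a complex multiplier is split into its real and
  -- imaginary parts; this is the source of the factor `2`.
  have hca : a = (fun i => ((RCLike.re (c i) : ℝ) : 𝕜) * b i) +
      (RCLike.I : 𝕜) • (fun i => ((RCLike.im (c i) : ℝ) : 𝕜) * b i) := by
    funext i
    have h1 : a i = c i * b i := by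
      rcases eq_or_ne (b i) 0 with h0 | h0
      · have := hab i
        rw [h0, norm_zero, norm_le_zero_iff] at this
        simp [this, h0]
      · simp [c, h0]
    simp only [Pi.add_apply, Pi.smul_apply, smul_eq_mul]
    rw [h1, ← mul_assoc, ← add_mul, mul_comm RCLike.I, RCLike.re_add_im]
  rw [hca, blockSum_add, blockSum_smul]
  refine (norm_add_le _ _).trans ?_
  have h1 := he.norm_blockSum_mul_real_le hψ b (fun i => RCLike.re (c i))
    fun i => (RCLike.abs_re_le_norm _).trans (hc i)
  have h2 := he.norm_blockSum_mul_real_le hψ b (fun i => RCLike.im (c i))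
    fun i => (RCLike.abs_im_le_norm _).trans (hc i)
  have h3 : ‖(RCLike.I : 𝕜) • blockSum e ψ (fun i => ((RCLike.im (c i) : ℝ) : 𝕜) * b i)‖ ≤
      ‖blockSum e ψ (fun i => ((RCLike.im (c i) : ℝ) : 𝕜) * b i)‖ := by
    rw [norm_smul]
    refine mul_le_of_le_one_left (norm_nonneg _) ?_
    rcases RCLike.I_eq_zero_or_im_I_eq_one (K := 𝕜) with h | h
    · simp [h]
    · exact (RCLike.norm_I_of_ne_zero (fun h0 => by simp [h0] at h)).le
  linarith

/-- The norm of `e 0 + ⋯ + e (n - 1)`. -/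
def fundamental (e : SchauderBasis 𝕜 X) (n : ℕ) : ℝ :=
  ‖blockSum e (fun i : Fin n => (i : ℕ)) 1‖

theorem norm_blockSum_one (he : IsOneSymmetric e) {ψ : ι → ℕ} (hψ : Function.Injective ψ) :
    ‖blockSum e ψ 1‖ = fundamental e (Fintype.card ι) :=
  he.norm_blockSum_comp Fin.val_injective hψ (Fintype.equivFin ι) 1

theorem fundamental_nonneg (n : ℕ) : 0 ≤ fundamental e n := norm_nonneg _

theorem norm_blockSum_indicator (he : IsOneSymmetric e) {ψ : ι → ℕ}
    (hψ : Function.Injective ψ) (p : ι → Prop) [DecidablePred p] :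
    ‖blockSum e ψ (fun i => if p i then 1 else 0)‖ =
      fundamental e (Finset.univ.filter p).card := by
  have h := he.norm_blockSum_one (ψ := fun i : {i // p i} => ψ i)
    (hψ.comp Subtype.val_injective)
  rw [Fintype.card_subtype] at h
  rw [← h]
  simp only [blockSum, ite_smul, one_smul, zero_smul, Pi.one_apply]
  rw [← Finset.sum_filter]
  congr 1
  exact Finset.sum_subtype _ (by simp) _

theorem fundamental_mono (he : IsOneSymmetric e) : Monotone (fundamental e) := by
  intro m n hmn
  have h := he.norm_blockSum_mul_real_le (ψ := fun i : Fin n => (i : ℕ)) Fin.val_injective 1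
    (fun i => if (i : ℕ) < m then 1 else 0) (fun i => by split_ifs <;> simp)
  have h2 := he.norm_blockSum_indicator (ψ := fun i : Fin n => (i : ℕ)) Fin.val_injective
    (fun i => (i : ℕ) < m)
  have h3 : (Finset.univ.filter fun i : Fin n => (i : ℕ) < m).card = m := by
    rw [Fin.card_filter_val_lt]
    omega
  rw [h3] at h2
  rw [← h2]
  refine le_trans (le_of_eq ?_) h
  congr 2
  funext i
  split_ifs <;> simp

theorem fundamental_one (he : IsOneSymmetric e) (i : ℕ) : fundamental e 1 = ‖e.basis i‖ := by
  rw [he.norm_basis_eq i 0]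
  simp [fundamental, blockSum]

theorem fundamental_pos (he : IsOneSymmetric e) {n : ℕ} (hn : 0 < n) : 0 < fundamental e n :=
  (he.fundamental_one 0 ▸ e.norm_basis_pos 0).trans_le (he.fundamental_mono hn)

theorem norm_blockSum_le_of_norm_le (he : IsOneSymmetric e) {ψ : ι → ℕ}
    (hψ : Function.Injective ψ) {a : ι → 𝕜} {s : ℝ} (ha : ∀ i, ‖a i‖ ≤ s) (hs : 0 ≤ s) :
    ‖blockSum e ψ a‖ ≤ 2 * s * fundamental e (Fintype.card ι) := by
  have h := he.norm_blockSum_le_two_mul hψ (a := a) (b := (s : 𝕜) • 1)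
    (fun i => by simpa [abs_of_nonneg hs] using ha i)
  rwa [blockSum_smul, norm_smul, he.norm_blockSum_one hψ, RCLike.norm_ofReal, abs_of_nonneg hs,
    ← mul_assoc] at h

/-- The norm as a function of the coefficients on a set of coordinates dominates the mean. -/
theorem sum_norm_mul_fundamental_le (he : IsOneSymmetric e) {ψ : ι → ℕ}
    (hψ : Function.Injective ψ) (a : ι → 𝕜) :
    (∑ i, ‖a i‖) * fundamental e (Fintype.card ι) ≤
      2 * Fintype.card ι * ‖blockSum e ψ a‖ := by
  rcases isEmpty_or_nonempty ι with hι | hι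
  · simp
  set n := Fintype.card ι
  have : NeZero n := ⟨Fintype.card_ne_zero⟩
  let σ : ι ≃ ZMod n := Fintype.equivOfCardEq (by simp [n])
  let b : ι → 𝕜 := fun i => (‖a i‖ : 𝕜)
  have hb : ‖blockSum e ψ b‖ ≤ 2 * ‖blockSum e ψ a‖ :=
    he.norm_blockSum_le_two_mul hψ fun i => by simp [b]
  let τ : ZMod n → ι ≃ ι := fun g => (σ.trans (Equiv.addRight g)).trans σ.symm
  -- The sum of all cyclic shifts of the moduli is constant, and each shift preserves the norm.
  have hsum : ∑ g : ZMod n, b ∘ τ g = ((∑ i, ‖a i‖ : ℝ) : 𝕜) • (1 : ι → 𝕜) := by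
    funext i
    simp only [Finset.sum_apply, Function.comp_apply, Pi.smul_apply, Pi.one_apply, smul_eq_mul,
      mul_one, RCLike.ofReal_sum]
    have h := ((Equiv.addLeft (σ i)).trans σ.symm).sum_comp b
    simpa [τ, b] using h
  have h1 : ‖blockSum e ψ (∑ g : ZMod n, b ∘ τ g)‖ ≤ n * ‖blockSum e ψ b‖ := by
    rw [blockSum_sum]
    refine (norm_sum_le _ _).trans (le_of_eq ?_)
    simp [he.norm_blockSum_comp hψ hψ]
  rw [hsum, blockSum_smul, norm_smul, he.norm_blockSum_one hψ, RCLike.norm_ofReal,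
    abs_of_nonneg (Finset.sum_nonneg fun i _ => norm_nonneg _)] at h1
  refine h1.trans ?_
  have : (0 : ℝ) ≤ n := by positivity
  nlinarith

end IsOneSymmetric

end

section

/-! ### Random signs with exponentially integrable sums -/

section RandomSigns

variable {𝕜 G J : Type*} [RCLike 𝕜] [Fintype G] [Fintype J] [DecidableEq J]

theorem sum_units_int {β : Type*} [AddCommMonoid β] (f : ℤˣ → β) : ∑ u, f u = f 1 + f (-1) := by
  rw [show (Finset.univ : Finset ℤˣ) = {1, -1} from rfl]
  exact Finset.sum_pair (by decide)

theorem card_signs : Fintype.card (J → ℤˣ) = 2 ^ Fintype.card J := by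
  rw [Fintype.card_fun]
  rfl

/-- The exponential moment of a Rademacher sum. -/
theorem sum_signs_exp_le (r : J → ℝ) :
    ∑ ε : J → ℤˣ, Real.exp (∑ j, ((ε j : ℤ) : ℝ) * r j) ≤
      2 ^ Fintype.card J * Real.exp ((∑ j, r j ^ 2) / 2) := by
  have h1 : ∑ ε : J → ℤˣ, Real.exp (∑ j, ((ε j : ℤ) : ℝ) * r j) =
      ∏ j, (2 * Real.cosh (r j)) := by
    simp only [Real.exp_sum]
    have h := Finset.prod_univ_sum (fun _ : J => (Finset.univ : Finset ℤˣ))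
      (fun j u => Real.exp (((u : ℤ) : ℝ) * r j))
    rw [Fintype.piFinset_univ] at h
    rw [← h]
    refine Finset.prod_congr rfl fun j _ => ?_
    rw [sum_units_int, Real.cosh_eq]
    simp
    ring
  rw [h1, Finset.prod_mul_distrib, Finset.prod_const, Finset.card_univ, Finset.sum_div,
    Real.exp_sum]
  gcongr with j
  exact Real.cosh_le_exp_half_sq _

theorem sum_signs_exp_abs_le (r : J → ℝ) :
    ∑ ε : J → ℤˣ, Real.exp |∑ j, ((ε j : ℤ) : ℝ) * r j| ≤
      2 ^ Fintype.card J * (2 * Real.exp ((∑ j, r j ^ 2) / 2)) := by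
  have h1 := sum_signs_exp_le r
  have h2 := sum_signs_exp_le (fun j => -r j)
  simp only [neg_sq, mul_neg, Finset.sum_neg_distrib] at h2
  have h3 : ∑ ε : J → ℤˣ, Real.exp |∑ j, ((ε j : ℤ) : ℝ) * r j| ≤
      ∑ ε : J → ℤˣ, (Real.exp (∑ j, ((ε j : ℤ) : ℝ) * r j) +
        Real.exp (-∑ j, ((ε j : ℤ) : ℝ) * r j)) := by
    gcongr with ε
    exact Real.exp_abs_le _
  rw [Finset.sum_add_distrib] at h3
  linarith

/-- There is a choice of signs for which the values of a trigonometric-like polynomial are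
exponentially integrable at the scale of the `ℓ₂` norm of its coefficients. -/
theorem exists_signs_sum_exp_le (W : G → J → 𝕜) (hW : ∀ g j, ‖W g j‖ ≤ 1) (c : J → 𝕜) {s : ℝ}
    (hs : 0 < s) (hc : ∑ j, ‖c j‖ ^ 2 ≤ s ^ 2) :
    ∃ ε : J → ℤˣ, ∑ g, Real.exp (‖∑ j, ((ε j : ℤ) : 𝕜) * (c j * W g j)‖ / s) ≤
      16 * Fintype.card G := by
  -- `T` will be the real or the imaginary part. The factor `2` in the exponent prepares the split
  -- `exp (u + v) ≤ (exp (2 u) + exp (2 v)) / 2`, and `16` bounds `2 e²`.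
  have hbase : ∀ g (T : 𝕜 →+ ℝ), (∀ z, |T z| ≤ ‖z‖) → (∀ (n : ℤ) z, T ((n : 𝕜) * z) = n * T z) →
      ∑ ε : J → ℤˣ, Real.exp (2 * |T (∑ j, ((ε j : ℤ) : 𝕜) * (c j * W g j))| / s) ≤
        2 ^ Fintype.card J * 16 := by
    intro g T hT hTm
    have h := sum_signs_exp_abs_le (fun j => 2 * T (c j * W g j) / s)
    have h2 : (∑ j, (2 * T (c j * W g j) / s) ^ 2) / 2 ≤ 2 := by
      have : ∑ j, (2 * T (c j * W g j) / s) ^ 2 ≤ ∑ j, 4 * ‖c j‖ ^ 2 / s ^ 2 := by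
        gcongr with j
        rw [div_pow, mul_pow, ← sq_abs (T _), show (2 : ℝ) ^ 2 = 4 by norm_num]
        have : |T (c j * W g j)| ≤ ‖c j‖ := (hT _).trans (by
          rw [norm_mul]
          exact mul_le_of_le_one_right (norm_nonneg _) (hW g j))
        gcongr
      rw [← Finset.sum_div, ← Finset.mul_sum] at this
      have h3 : 4 * ∑ j, ‖c j‖ ^ 2 ≤ 4 * s ^ 2 := by gcongr
      have h4 := (div_le_iff₀ (by positivity : 0 < s ^ 2)).2 h3
      linarith
    have h5 : 2 * Real.exp ((∑ j, (2 * T (c j * W g j) / s) ^ 2) / 2) ≤ 16 := by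
      have e1 : Real.exp 2 ≤ 8 := by
        have := Real.exp_one_lt_d9
        have e0 : Real.exp 2 = Real.exp 1 * Real.exp 1 := by
          rw [← Real.exp_add]
          norm_num
        have := Real.exp_pos 1
        nlinarith
      have := Real.exp_le_exp.2 h2
      linarith
    refine le_trans (le_of_eq ?_) (h.trans (by gcongr))
    refine Finset.sum_congr rfl fun ε _ => ?_
    congr 1
    rw [map_sum, mul_div_assoc, mul_comm, div_mul_eq_mul_div, ← abs_of_pos hs, mul_comm,
      ← abs_two (α := ℝ), ← abs_mul, ← abs_div, abs_of_pos hs, abs_two, Finset.mul_sum,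
      Finset.sum_div]
    congr 1
    refine Finset.sum_congr rfl fun j _ => ?_
    rw [hTm]
    ring
  have key : ∑ ε : J → ℤˣ, ∑ g, Real.exp (‖∑ j, ((ε j : ℤ) : 𝕜) * (c j * W g j)‖ / s) ≤
      ∑ _ε : J → ℤˣ, 16 * (Fintype.card G : ℝ) := by
    rw [Finset.sum_comm, Finset.sum_const, Finset.card_univ, card_signs, nsmul_eq_mul]
    have hg : ∀ g, ∑ ε : J → ℤˣ, Real.exp (‖∑ j, ((ε j : ℤ) : 𝕜) * (c j * W g j)‖ / s) ≤
        2 ^ Fintype.card J * 16 := by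
      intro g
      have hre := hbase g (RCLike.re : 𝕜 →+ ℝ) RCLike.abs_re_le_norm (fun n z => by simp)
      have him := hbase g (RCLike.im : 𝕜 →+ ℝ) RCLike.abs_im_le_norm (fun n z => by simp)
      have : ∀ z : 𝕜, Real.exp (‖z‖ / s) ≤ (Real.exp (2 * |RCLike.re z| / s) +
          Real.exp (2 * |RCLike.im z| / s)) / 2 := by
        intro z
        have h1 : ‖z‖ / s ≤ |RCLike.re z| / s + |RCLike.im z| / s := by
          rw [← add_div]
          gcongr
          conv_lhs => rw [← RCLike.re_add_im z]
          refine (norm_add_le _ _).trans ?_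
          rw [norm_mul, RCLike.norm_ofReal, RCLike.norm_ofReal]
          gcongr
          refine mul_le_of_le_one_right (abs_nonneg _) ?_
          rcases RCLike.I_eq_zero_or_im_I_eq_one (K := 𝕜) with h | h
          · simp [h]
          · exact (RCLike.norm_I_of_ne_zero (fun h0 => by simp [h0] at h)).le
        refine (Real.exp_le_exp.2 h1).trans ?_
        rw [Real.exp_add, mul_div_assoc, mul_div_assoc, two_mul, two_mul, Real.exp_add,
          Real.exp_add]
        nlinarith [sq_nonneg (Real.exp (|RCLike.re z| / s) - Real.exp (|RCLike.im z| / s))]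
      refine (Finset.sum_le_sum fun ε _ => this _).trans ?_
      rw [← Finset.sum_div, Finset.sum_add_distrib]
      linarith
    refine (Finset.sum_le_sum fun g _ => hg g).trans (le_of_eq ?_)
    simp
    ring
  obtain ⟨ε, -, hε⟩ := Finset.exists_le_of_sum_le Finset.univ_nonempty key
  exact ⟨ε, hε⟩

/-- From `u ^ N / N! ≤ exp u`. Different moments are used: the third for the lower estimate, the
fourth under cotype 2, the first and `q`-th in Orlicz spaces. -/
theorem sum_pow_le_of_sum_exp_le {ι : Type*} [Fintype ι] {y : ι → 𝕜} {s : ℝ} (hs : 0 < s)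
    (hy : ∑ i, Real.exp (‖y i‖ / s) ≤ 16 * Fintype.card ι) (N : ℕ) :
    ∑ i, ‖y i‖ ^ N ≤ 16 * N.factorial * Fintype.card ι * s ^ N := by
  have h : ∀ i, ‖y i‖ ^ N ≤ N.factorial * s ^ N * Real.exp (‖y i‖ / s) := fun i => by
    have := Real.pow_div_factorial_le_exp (x := ‖y i‖ / s) (by positivity) N
    rw [div_le_iff₀ (by positivity), div_pow, div_le_iff₀ (by positivity)] at this
    linarith
  refine (Finset.sum_le_sum fun i _ => h i).trans ?_
  rw [← Finset.mul_sum]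
  calc _ ≤ N.factorial * s ^ N * (16 * Fintype.card ι) := by gcongr
    _ = _ := by ring

end RandomSigns

end

section

/-! ### Complete families of characters of finite abelian groups -/

open ComplexConjugate

/-- The characters `χ j` are pairwise orthogonal, and there are as many of them as elements of the
group; this is recorded by the two orthogonality relations. -/
structure IsCompleteCharacterFamily {𝕜 G J : Type*} [RCLike 𝕜] [AddCommGroup G] [Fintype G]
    [Fintype J] (χ : J → AddChar G 𝕜) : Prop where
  orthogonal : ∀ i j, i ≠ j → ∑ g, conj (χ i g) * χ j g = 0
  dual : ∀ g h, g ≠ h → ∑ j, conj (χ j g) * χ j h = 0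
  card_eq : Fintype.card J = Fintype.card G

variable {𝕜 G J : Type*} [RCLike 𝕜] [AddCommGroup G] [Fintype G] [Fintype J]

theorem AddChar.conj_mul_self_eq_one (χ : AddChar G 𝕜) (g : G) : conj (χ g) * χ g = 1 := by
  rw [RCLike.conj_mul, AddChar.norm_apply]
  simp

/-- The Fourier coefficient of `a` at the character `χ`. -/
def charCoeff (χ : AddChar G 𝕜) (a : G → 𝕜) : 𝕜 :=
  (Fintype.card G : 𝕜)⁻¹ * ∑ g, conj (χ g) * a g

namespace IsCompleteCharacterFamily

variable {χ : J → AddChar G 𝕜}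

theorem charCoeff_self (χ : AddChar G 𝕜) : charCoeff χ χ = 1 := by
  simp [charCoeff, AddChar.conj_mul_self_eq_one]

theorem charCoeff_ne (hχ : IsCompleteCharacterFamily χ) {i j : J} (hij : i ≠ j) :
    charCoeff (χ i) (χ j) = 0 := by
  simp [charCoeff, hχ.orthogonal i j hij]

theorem sum_charCoeff_mul (hχ : IsCompleteCharacterFamily χ) (a : G → 𝕜) :
    ∑ j, charCoeff (χ j) a • (χ j : G → 𝕜) = a := by
  classical
  funext g
  simp only [charCoeff, Finset.sum_apply, Pi.smul_apply, smul_eq_mul, mul_assoc]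
  rw [← Finset.mul_sum]
  simp only [Finset.sum_mul]
  rw [Finset.sum_comm, Finset.sum_eq_single g]
  · have : ∀ j, conj (χ j g) * a g * χ j g = a g := fun j => by
      rw [mul_right_comm, AddChar.conj_mul_self_eq_one, one_mul]
    simp [this, hχ.card_eq]
  · intro h _ hh
    have := hχ.dual h g hh
    have h2 : ∀ j, conj (χ j h) * a h * χ j g = a h * (conj (χ j h) * χ j g) := fun j => by ring
    simp only [h2]
    rw [← Finset.mul_sum, this, mul_zero]
  · simp

/-- Parseval's identity. -/
theorem sum_norm_sq (hχ : IsCompleteCharacterFamily χ) (c : J → 𝕜) :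
    ∑ g, ‖∑ j, c j * χ j g‖ ^ 2 = Fintype.card G * ∑ j, ‖c j‖ ^ 2 := by
  classical
  suffices h : ((∑ g, ‖∑ j, c j * χ j g‖ ^ 2 : ℝ) : 𝕜) =
      ((Fintype.card G * ∑ j, ‖c j‖ ^ 2 : ℝ) : 𝕜) by exact_mod_cast h
  push_cast
  simp only [← RCLike.conj_mul, map_sum, map_mul]
  simp only [Finset.sum_mul_sum]
  rw [Finset.sum_comm, Finset.mul_sum]
  refine Finset.sum_congr rfl fun i _ => ?_
  rw [Finset.sum_comm, Finset.sum_eq_single i]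
  · have : ∀ g, conj (c i) * conj (χ i g) * (c i * χ i g) = conj (c i) * c i := fun g => by
      rw [mul_mul_mul_comm, AddChar.conj_mul_self_eq_one, mul_one]
    simp [this]
  · intro j _ hj
    have h2 : ∀ g, conj (c i) * conj (χ i g) * (c j * χ j g) =
        conj (c i) * c j * (conj (χ i g) * χ j g) := fun g => by ring
    simp only [h2]
    rw [← Finset.mul_sum, hχ.orthogonal i j hj.symm, mul_zero]
  · simp

end IsCompleteCharacterFamily

namespace IsOneSymmetric

variable {X : Type*} [NormedAddCommGroup X] [NormedSpace 𝕜 X] {e : SchauderBasis 𝕜 X}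

theorem blockSum_eq_sum_charCoeff {χ : J → AddChar G 𝕜} (hχ : IsCompleteCharacterFamily χ)
    (ψ : G → ℕ) (a : G → 𝕜) :
    blockSum e ψ a = ∑ j, charCoeff (χ j) a • blockSum e ψ (χ j) := by
  conv_lhs => rw [← hχ.sum_charCoeff_mul a]
  simp only [blockSum_sum, blockSum_smul]

/-- The projection onto a character is contractive, being a mean of translations. -/
theorem norm_charCoeff_mul_le (he : IsOneSymmetric e) {ψ : G → ℕ} (hψ : Function.Injective ψ)
    (χ : AddChar G 𝕜) (a : G → 𝕜) :
    ‖charCoeff χ a‖ * ‖blockSum e ψ χ‖ ≤ ‖blockSum e ψ a‖ := by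
  have hn : (Fintype.card G : 𝕜) ≠ 0 := Nat.cast_ne_zero.2 Fintype.card_ne_zero
  have hn' : (0 : ℝ) < Fintype.card G := Nat.cast_pos.2 Fintype.card_pos
  -- Averaging the translates of `a` against `conj χ` retains only the `χ` component.
  have h1 : ∑ h, conj (χ h) • (a ∘ Equiv.addRight h) =
      ((Fintype.card G : 𝕜) * charCoeff χ a) • (χ : G → 𝕜) := by
    funext g
    simp only [Finset.sum_apply, Pi.smul_apply, Function.comp_apply, Equiv.coe_addRight,
      smul_eq_mul, charCoeff, mul_inv_cancel_left₀ hn]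
    rw [← Equiv.sum_comp (Equiv.addLeft g) (fun u => conj (χ u) * a u), Finset.sum_mul]
    refine Finset.sum_congr rfl fun h _ => ?_
    simp only [Equiv.coe_addLeft, AddChar.map_add_eq_mul, map_mul]
    have := AddChar.conj_mul_self_eq_one χ g
    linear_combination (-(conj (χ h) * a (g + h))) * this
  have h2 : ‖blockSum e ψ (∑ h, conj (χ h) • (a ∘ Equiv.addRight h))‖ ≤
      Fintype.card G * ‖blockSum e ψ a‖ := by
    rw [blockSum_sum]
    refine (norm_sum_le _ _).trans (le_of_eq ?_)
    simp only [blockSum_smul, norm_smul, RCLike.norm_conj, AddChar.norm_apply, one_mul,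
      he.norm_blockSum_comp hψ hψ]
    simp
  rw [h1, blockSum_smul, norm_smul, norm_mul, RCLike.norm_natCast, mul_assoc] at h2
  exact le_of_mul_le_mul_left h2 hn'

theorem norm_blockSum_character_le (he : IsOneSymmetric e) {ψ : G → ℕ}
    (hψ : Function.Injective ψ) (χ : AddChar G 𝕜) :
    ‖blockSum e ψ χ‖ ≤ 2 * fundamental e (Fintype.card G) := by
  have := he.norm_blockSum_le_of_norm_le hψ (a := χ) (s := 1)
    (fun g => (AddChar.norm_apply χ g).le) zero_le_one
  simpa using this

theorem norm_blockSum_character_pos {ψ : G → ℕ}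
    (hψ : Function.Injective ψ) (χ : AddChar G 𝕜) : 0 < ‖blockSum e ψ χ‖ := by
  rw [norm_pos_iff]
  intro h
  have := coord_blockSum (e := e) hψ (χ : G → 𝕜) 0
  simp [h] at this

end IsOneSymmetric

end

section

/-! ### Consequences of type 2 and cotype 2 -/

section TypeCotype

variable {X : Type*} [NormedAddCommGroup X]

theorem le_rademacherAverage {m : ℕ} {x : Fin m → X} {D : ℝ}
    (h : ∀ ε : Fin m → ℤˣ, D ≤ ‖∑ i, (ε i : ℤ) • x i‖) : D ≤ rademacherAverage x := by
  rw [rademacherAverage, le_div_iff₀ (by positivity)]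
  calc D * 2 ^ m = ∑ _ε : Fin m → ℤˣ, D := by
        rw [Finset.sum_const, Finset.card_univ, card_signs, Fintype.card_fin, nsmul_eq_mul]
        push_cast
        ring
    _ ≤ _ := Finset.sum_le_sum fun ε _ => h ε

theorem rademacherAverage_le {m : ℕ} {x : Fin m → X} {D : ℝ}
    (h : ∀ ε : Fin m → ℤˣ, ‖∑ i, (ε i : ℤ) • x i‖ ≤ D) : rademacherAverage x ≤ D := by
  rw [rademacherAverage, div_le_iff₀ (by positivity)]
  calc _ ≤ ∑ _ε : Fin m → ℤˣ, D := Finset.sum_le_sum fun ε _ => h ε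
    _ = D * 2 ^ m := by
        rw [Finset.sum_const, Finset.card_univ, card_signs, Fintype.card_fin, nsmul_eq_mul]
        push_cast
        ring

/-- A lower bound valid for all signs passes to the mean. For unconditional systems all signed sums
are comparable, so this form suffices; it also frees the index type and makes the constant positive.
-/
theorem HasTypeTwo.exists_le (h : HasTypeTwo X) :
    ∃ C : ℝ, 0 < C ∧ ∀ (J : Type) [Fintype J] (x : J → X) (D : ℝ),
      (∀ ε : J → ℤˣ, D ≤ ‖∑ j, (ε j : ℤ) • x j‖) → D ≤ C * √(∑ j, ‖x j‖ ^ 2) := by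
  obtain ⟨C, hC⟩ := h
  refine ⟨|C| + 1, by positivity, fun J _ x D hD => ?_⟩
  let σ := (Fintype.equivFin J).symm
  have h1 : D ≤ rademacherAverage (x ∘ σ) := le_rademacherAverage fun ε => by
    refine (hD (ε ∘ σ.symm)).trans (le_of_eq ?_)
    rw [← σ.sum_comp]
    simp
  refine (h1.trans (hC _ _)).trans ?_
  have h2 : ∑ i, ‖(x ∘ σ) i‖ ^ 2 = ∑ j, ‖x j‖ ^ 2 := σ.sum_comp fun j => ‖x j‖ ^ 2
  rw [h2]
  gcongr
  linarith [le_abs_self C]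

theorem HasCotypeTwo.exists_le (h : HasCotypeTwo X) :
    ∃ C : ℝ, 0 < C ∧ ∀ (J : Type) [Fintype J] (x : J → X) (D : ℝ),
      (∀ ε : J → ℤˣ, ‖∑ j, (ε j : ℤ) • x j‖ ≤ D) → √(∑ j, ‖x j‖ ^ 2) ≤ C * D := by
  obtain ⟨C, hC⟩ := h
  refine ⟨|C| + 1, by positivity, fun J _ x D hD => ?_⟩
  let σ := (Fintype.equivFin J).symm
  have h1 : rademacherAverage (x ∘ σ) ≤ D := rademacherAverage_le fun ε => by
    refine (le_of_eq ?_).trans (hD (ε ∘ σ.symm))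
    rw [← σ.sum_comp]
    simp
  have h0 : 0 ≤ rademacherAverage (x ∘ σ) := by
    rw [rademacherAverage]
    positivity
  have h2 : ∑ i, ‖(x ∘ σ) i‖ ^ 2 = ∑ j, ‖x j‖ ^ 2 := σ.sum_comp fun j => ‖x j‖ ^ 2
  rw [← h2]
  calc _ ≤ C * rademacherAverage (x ∘ σ) := hC _ _
    _ ≤ (|C| + 1) * rademacherAverage (x ∘ σ) := by
        gcongr
        linarith [le_abs_self C]
    _ ≤ _ := by gcongr

end TypeCotype

/-! ### Unconditional systems of characters force `ℓ₂` estimates -/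

namespace IsOneSymmetric

variable {𝕜 X : Type*} [RCLike 𝕜] [NormedAddCommGroup X] [NormedSpace 𝕜 X]

/-- Coefficients that are exponentially integrable at scale `s` have norm comparable with that of
the constant coefficients `s`. -/
def FlatBound (e : SchauderBasis 𝕜 X) : Prop :=
  ∃ B : ℝ, 0 < B ∧ ∀ (n : ℕ) (y : Fin n → 𝕜) (s : ℝ), 0 < s →
    ∑ i, Real.exp (‖y i‖ / s) ≤ 16 * n →
    ‖blockSum e (fun i : Fin n => (i : ℕ)) y‖ ≤ B * s * fundamental e n

/-- The basis is equivalent to the unit vector basis of `ℓ₂`. -/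
def IsEquivalentToHilbertBasis (e : SchauderBasis 𝕜 X) : Prop :=
  ∃ c C : ℝ, 0 < c ∧ ∀ (n : ℕ) (a : Fin n → 𝕜),
    c * √(∑ i, ‖a i‖ ^ 2) ≤ ‖blockSum e (fun i : Fin n => (i : ℕ)) a‖ ∧
    ‖blockSum e (fun i : Fin n => (i : ℕ)) a‖ ≤ C * √(∑ i, ‖a i‖ ^ 2)

variable {G J : Type} [AddCommGroup G] [Fintype G] [Fintype J] {e : SchauderBasis 𝕜 X}

/-- Changing the signs of the coefficients of the vectors of characters on a block increases the
norm at most by the factor `C`. -/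
def SignBound (e : SchauderBasis 𝕜 X) (ψ : G → ℕ) (χ : J → AddChar G 𝕜) (C : ℝ) : Prop :=
  ∀ (c : J → 𝕜) (ε : J → ℤˣ), ‖∑ j, ((ε j : ℤ) : 𝕜) • c j • blockSum e ψ (χ j)‖ ≤
    C * ‖∑ j, c j • blockSum e ψ (χ j)‖

/-- Random signs on the Fourier coefficients of `a`: Parseval keeps the `ℓ₂` norm, and `SignBound`
controls the norm in both directions because the sign change is an involution. -/
theorem exists_flat {χ : J → AddChar G 𝕜} (hχ : IsCompleteCharacterFamily χ)
    {ψ : G → ℕ} {C : ℝ} (hC : SignBound e ψ χ C) (a : G → 𝕜) {s : ℝ}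
    (hs : 0 < s) (ha : ∑ g, ‖a g‖ ^ 2 = Fintype.card G * s ^ 2) :
    ∃ y : G → 𝕜, ‖blockSum e ψ a‖ ≤ C * ‖blockSum e ψ y‖ ∧
      ‖blockSum e ψ y‖ ≤ C * ‖blockSum e ψ a‖ ∧
      ∑ g, ‖y g‖ ^ 2 = Fintype.card G * s ^ 2 ∧
      ∑ g, Real.exp (‖y g‖ / s) ≤ 16 * Fintype.card G := by
  classical
  have hn : (0 : ℝ) < Fintype.card G := Nat.cast_pos.2 Fintype.card_pos
  set c : J → 𝕜 := fun j => charCoeff (χ j) a with hc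
  have hac : ∀ g, a g = ∑ j, c j * χ j g := fun g => by
    conv_lhs => rw [← hχ.sum_charCoeff_mul a]
    simp [hc]
  have hcs : ∑ j, ‖c j‖ ^ 2 = s ^ 2 := by
    have h := hχ.sum_norm_sq c
    simp only [← hac, ha] at h
    exact (mul_left_cancel₀ hn.ne' h).symm
  obtain ⟨ε, hε⟩ := exists_signs_sum_exp_le (fun g j => χ j g)
    (fun g j => (AddChar.norm_apply (χ j) g).le) c hs hcs.le
  set y : G → 𝕜 := fun g => ∑ j, ((ε j : ℤ) : 𝕜) * (c j * χ j g) with hy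
  have hyV : blockSum e ψ y = ∑ j, ((ε j : ℤ) : 𝕜) • c j • blockSum e ψ (χ j) := by
    have : y = ∑ j, ((ε j : ℤ) : 𝕜) • c j • (χ j : G → 𝕜) := by
      funext g
      simp [hy]
    rw [this, blockSum_sum]
    simp only [blockSum_smul]
  have haV : blockSum e ψ a = ∑ j, c j • blockSum e ψ (χ j) :=
    blockSum_eq_sum_charCoeff hχ ψ a
  have hεε : ∀ j, ((ε j : ℤ) : 𝕜) * ((ε j : ℤ) : 𝕜) = 1 := fun j => by
    rw [← Int.cast_mul, ← Units.val_mul, Int.units_mul_self]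
    simp
  refine ⟨y, ?_, ?_, ?_, hε⟩
  · have h := hC (fun j => ((ε j : ℤ) : 𝕜) * c j) ε
    simp only [mul_smul] at h
    rw [← hyV] at h
    refine le_trans (le_of_eq ?_) h
    rw [haV]
    congr 1
    refine Finset.sum_congr rfl fun j _ => ?_
    rw [← mul_smul, hεε, one_smul]
  · rw [hyV, haV]
    exact hC c ε
  · have h := hχ.sum_norm_sq (fun j => ((ε j : ℤ) : 𝕜) * c j)
    have hnorm : ∀ j, ‖((ε j : ℤ) : 𝕜) * c j‖ = ‖c j‖ := fun j => by
      rcases Int.units_eq_one_or (ε j) with h | h <;> simp [h]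
    simp only [hnorm, hcs, mul_assoc] at h
    exact h

/-- A second moment of order `s²` with a third moment `O(s³)` forces a first moment of order `s`,
and the norm dominates the mean modulus times `λ(n)`. -/
theorem scale_mul_fundamental_le (he : IsOneSymmetric e) {ψ : G → ℕ}
    (hψ : Function.Injective ψ) {y : G → 𝕜} {s : ℝ} (hs : 0 < s)
    (h2 : ∑ g, ‖y g‖ ^ 2 = Fintype.card G * s ^ 2)
    (hy : ∑ g, Real.exp (‖y g‖ / s) ≤ 16 * Fintype.card G) :
    s * fundamental e (Fintype.card G) ≤ 192 * ‖blockSum e ψ y‖ := by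
  have hn : (0 : ℝ) < Fintype.card G := Nat.cast_pos.2 Fintype.card_pos
  have h3 := sum_pow_le_of_sum_exp_le hs hy 3
  have hmean := he.sum_norm_mul_fundamental_le hψ y
  set n : ℝ := (Fintype.card G : ℝ)
  -- This is `‖y g‖ (96 s - ‖y g‖)² ≥ 0`, with `96 = 16 · 3!` the constant of the third moment, so
  -- that half of the left side absorbs the cubes.
  have hpt : ∀ g, 192 * s * ‖y g‖ ^ 2 ≤ 9216 * s ^ 2 * ‖y g‖ + ‖y g‖ ^ 3 := fun g => by
    nlinarith [mul_nonneg (norm_nonneg (y g)) (sq_nonneg (96 * s - ‖y g‖))]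
  have hsum := Finset.sum_le_sum fun g (_ : g ∈ Finset.univ) => hpt g
  rw [← Finset.mul_sum, Finset.sum_add_distrib, ← Finset.mul_sum, h2] at hsum
  have h3' : ∑ g, ‖y g‖ ^ 3 ≤ 96 * n * s ^ 3 := by
    refine h3.trans (le_of_eq ?_)
    norm_num [Nat.factorial]
  have h4 : s ^ 2 * (n * s) ≤ s ^ 2 * (96 * ∑ g, ‖y g‖) := by nlinarith
  have h5 : n * s ≤ 96 * ∑ g, ‖y g‖ := le_of_mul_le_mul_left h4 (by positivity)
  have h6 := fundamental_nonneg (e := e) (Fintype.card G)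
  have h7 : n * (s * fundamental e (Fintype.card G)) ≤ n * (192 * ‖blockSum e ψ y‖) := by
    have := mul_le_mul_of_nonneg_right h5 h6
    nlinarith
  exact le_of_mul_le_mul_left h7 hn

/-- The lower estimate on a block whose characters form an unconditional system. -/
theorem l2_mul_fundamental_le (he : IsOneSymmetric e) {χ : J → AddChar G 𝕜}
    (hχ : IsCompleteCharacterFamily χ) {ψ : G → ℕ} (hψ : Function.Injective ψ) {C : ℝ}
    (hC : SignBound e ψ χ C) (a : G → 𝕜) :
    √(∑ g, ‖a g‖ ^ 2) * (fundamental e (Fintype.card G) / √(Fintype.card G)) ≤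
      192 * C * ‖blockSum e ψ a‖ := by
  have hn : (0 : ℝ) < Fintype.card G := Nat.cast_pos.2 Fintype.card_pos
  rcases eq_or_lt_of_le (Finset.sum_nonneg fun g (_ : g ∈ Finset.univ) => sq_nonneg ‖a g‖)
    with h0 | h0
  · have ha : a = 0 := by
      funext g
      have := (Finset.sum_eq_zero_iff_of_nonneg fun g _ => sq_nonneg ‖a g‖).1 h0.symm g
        (Finset.mem_univ g)
      simpa using this
    simp [ha, blockSum]
  · set s := √(∑ g, ‖a g‖ ^ 2) / √(Fintype.card G) with hsdef
    have hs : 0 < s := by positivity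
    obtain ⟨y, -, hya, h2, hexp⟩ := exists_flat hχ hC a hs (by
      rw [hsdef, div_pow, Real.sq_sqrt h0.le, Real.sq_sqrt hn.le]
      field_simp)
    have h := he.scale_mul_fundamental_le hψ hs h2 hexp
    calc _ = s * fundamental e (Fintype.card G) := by rw [hsdef]; ring
      _ ≤ _ := h
      _ ≤ 192 * C * ‖blockSum e ψ a‖ := by linarith

theorem norm_blockSum_le_l2_of_flatBound (he : IsOneSymmetric e) {χ : J → AddChar G 𝕜}
    (hχ : IsCompleteCharacterFamily χ) {ψ : G → ℕ} (hψ : Function.Injective ψ) {B C : ℝ}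
    (hC0 : 0 < C) (hC : SignBound e ψ χ C)
    (hB : ∀ (n : ℕ) (y : Fin n → 𝕜) (s : ℝ), 0 < s → ∑ i, Real.exp (‖y i‖ / s) ≤ 16 * n →
      ‖blockSum e (fun i : Fin n => (i : ℕ)) y‖ ≤ B * s * fundamental e n) (a : G → 𝕜) :
    ‖blockSum e ψ a‖ ≤
      C * B * (√(∑ g, ‖a g‖ ^ 2) * (fundamental e (Fintype.card G) / √(Fintype.card G))) := by
  have hn : (0 : ℝ) < Fintype.card G := Nat.cast_pos.2 Fintype.card_pos
  rcases eq_or_lt_of_le (Finset.sum_nonneg fun g (_ : g ∈ Finset.univ) => sq_nonneg ‖a g‖)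
    with h0 | h0
  · have ha : a = 0 := by
      funext g
      have := (Finset.sum_eq_zero_iff_of_nonneg fun g _ => sq_nonneg ‖a g‖).1 h0.symm g
        (Finset.mem_univ g)
      simpa using this
    simp [ha, blockSum]
  · set s := √(∑ g, ‖a g‖ ^ 2) / √(Fintype.card G) with hsdef
    have hs : 0 < s := by positivity
    obtain ⟨y, hay, -, h2, hexp⟩ := exists_flat hχ hC a hs (by
      rw [hsdef, div_pow, Real.sq_sqrt h0.le, Real.sq_sqrt hn.le]
      field_simp)
    let σ := (Fintype.equivFin G).symm
    have h := hB _ (y ∘ σ) s hs (by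
      rw [← σ.sum_comp] at hexp
      exact hexp)
    rw [he.norm_blockSum_comp hψ Fin.val_injective σ y] at h
    calc _ ≤ _ := hay
      _ ≤ C * (B * s * fundamental e (Fintype.card G)) := by gcongr
      _ = _ := by rw [hsdef]; ring

/-- There are arbitrarily long blocks on which a complete family of characters gives an
unconditional system, with a common constant. -/
def HasUnconditionalCharacterBlocks (e : SchauderBasis 𝕜 X) : Prop :=
  ∃ C : ℝ, 0 < C ∧ ∀ m : ℕ, ∃ (G J : Type) (_ : AddCommGroup G) (_ : Fintype G) (_ : Fintype J)
    (ψ : G → ℕ) (χ : J → AddChar G 𝕜), m ≤ Fintype.card G ∧ Function.Injective ψ ∧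
      IsCompleteCharacterFamily χ ∧ SignBound e ψ χ C

/-- By symmetry, any `n` coefficients can be placed inside a sufficiently long block and padded with
zeros. -/
theorem isEquivalentToHilbertBasis_of_blocks (he : IsOneSymmetric e) {c C : ℝ} (hc : 0 < c)
    (h : ∀ m : ℕ, ∃ (G : Type) (_ : Fintype G) (ψ : G → ℕ), m ≤ Fintype.card G ∧
      Function.Injective ψ ∧ ∀ a : G → 𝕜, c * √(∑ g, ‖a g‖ ^ 2) ≤ ‖blockSum e ψ a‖ ∧
        ‖blockSum e ψ a‖ ≤ C * √(∑ g, ‖a g‖ ^ 2)) : IsEquivalentToHilbertBasis e := by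
  classical
  refine ⟨c, C, hc, fun n a => ?_⟩
  obtain ⟨G, _, ψ, hn, hψ, hG⟩ := h n
  obtain ⟨f⟩ : Nonempty (Fin n ↪ G) := Function.Embedding.nonempty_of_card_le (by simpa using hn)
  have h1 := hG (Function.extend f a 0)
  have h2 : ∑ g, ‖Function.extend f a 0 g‖ ^ 2 = ∑ i, ‖a i‖ ^ 2 := by
    rw [← Finset.sum_subset (Finset.subset_univ (Finset.univ.image f)),
      Finset.sum_image f.injective.injOn]
    · simp [f.injective.extend_apply]
    · intro i _ hi
      rw [Function.extend_apply', Pi.zero_apply, norm_zero]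
      · simp
      rintro ⟨j, rfl⟩
      exact hi (Finset.mem_image_of_mem f (Finset.mem_univ j))
  rwa [h2, blockSum_extend f.injective,
    he.norm_blockSum_congr (hψ.comp f.injective) Fin.val_injective a] at h1

theorem isEquivalentToHilbertBasis_of_flatBound (he : IsOneSymmetric e) (hflat : FlatBound e)
    (hblocks : HasUnconditionalCharacterBlocks e) : IsEquivalentToHilbertBasis e := by
  classical
  obtain ⟨B, hB0, hB⟩ := hflat
  obtain ⟨C, hC0, hC⟩ := hblocks
  have hα := e.norm_basis_pos 0
  set α := ‖e.basis 0‖ with hαdef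
  refine he.isEquivalentToHilbertBasis_of_blocks (c := α / (192 * C * (C * B)))
    (C := C * B * (192 * C * α)) (by positivity) fun m => ?_
  obtain ⟨G, J, _, _, _, ψ, χ, hm, hψ, hχ, hsign⟩ := hC m
  refine ⟨G, inferInstance, ψ, hm, hψ, fun a => ?_⟩
  have hlow := he.l2_mul_fundamental_le hχ hψ hsign
  have hup := he.norm_blockSum_le_l2_of_flatBound hχ hψ hC0 hsign hB
  set r := fundamental e (Fintype.card G) / √(Fintype.card G)
  have h1 : √(∑ g : G, ‖(Pi.single 0 1 : G → 𝕜) g‖ ^ 2) = 1 := by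
    simp [Pi.single_apply, apply_ite]
  -- A single basis vector has norm `α` and `ℓ₂` norm `1`; testing both estimates on it bounds `r`
  -- above and below independently of the block.
  have hlow0 := hlow (Pi.single 0 1)
  have hup0 := hup (Pi.single 0 1)
  rw [h1, one_mul, blockSum_single, he.norm_basis_eq _ 0] at hlow0 hup0
  have ha := hlow a
  have hb := hup a
  have hN : 0 ≤ √(∑ g, ‖a g‖ ^ 2) := Real.sqrt_nonneg _
  constructor
  · rw [div_mul_eq_mul_div, div_le_iff₀ (by positivity)]
    calc α * √(∑ g, ‖a g‖ ^ 2) ≤ C * B * r * √(∑ g, ‖a g‖ ^ 2) := by gcongr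
      _ = C * B * (√(∑ g, ‖a g‖ ^ 2) * r) := by ring
      _ ≤ C * B * (192 * C * ‖blockSum e ψ a‖) := by gcongr
      _ = _ := by ring
  · calc _ ≤ _ := hb
      _ ≤ C * B * (√(∑ g, ‖a g‖ ^ 2) * (192 * C * α)) := by gcongr
      _ = _ := by ring

theorem isEquivalentToHilbertBasis_of_hasTypeTwo (he : IsOneSymmetric e) (htype : HasTypeTwo X)
    (hblocks : HasUnconditionalCharacterBlocks e) : IsEquivalentToHilbertBasis e := by
  classical
  obtain ⟨T, hT0, hT⟩ := htype.exists_le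
  obtain ⟨C, hC0, hC⟩ := hblocks
  have hα := e.norm_basis_pos 0
  set α := ‖e.basis 0‖ with hαdef
  refine he.isEquivalentToHilbertBasis_of_blocks (c := α / (192 * C * (2 * C * T)))
    (C := T * α) (by positivity) fun m => ?_
  obtain ⟨G, J, _, _, _, ψ, χ, hm, hψ, hχ, hsign⟩ := hC m
  have hn : (0 : ℝ) < Fintype.card G := Nat.cast_pos.2 Fintype.card_pos
  refine ⟨G, inferInstance, ψ, hm, hψ, fun a => ⟨?_, ?_⟩⟩
  · have hlow := he.l2_mul_fundamental_le hχ hψ hsign a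
    set r := fundamental e (Fintype.card G) / √(Fintype.card G) with hr
    -- expand a basis vector into characters
    have hr0 : α ≤ 2 * C * T * r := by
      set c : J → 𝕜 := fun j => charCoeff (χ j) (Pi.single 0 1) with hc
      have hexp : e.basis (ψ 0) = ∑ j, c j • blockSum e ψ (χ j) := by
        rw [← blockSum_single]
        exact blockSum_eq_sum_charCoeff hχ ψ _
      have hcn : ∀ j, ‖c j‖ = (Fintype.card G : ℝ)⁻¹ := fun j => by
        simp [hc, charCoeff, Pi.single_apply]
      -- Undoing any choice of signs restores the basis vector at the cost of a factor `C`, so every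
      -- signed sum has norm at least `α / C`.
      have h1 := hT J (fun j => c j • blockSum e ψ (χ j)) (α / C) fun ε => by
        rw [div_le_iff₀' hC0]
        have h2 := hsign (fun j => ((ε j : ℤ) : 𝕜) * c j) ε
        have hεε : ∀ j (x : X), ((ε j : ℤ) : 𝕜) • ((ε j : ℤ) : 𝕜) • x = x := fun j x => by
          rw [smul_smul, ← Int.cast_mul, ← Units.val_mul, Int.units_mul_self]
          simp
        simp only [mul_smul, hεε] at h2
        rw [← hexp] at h2
        rw [hαdef, ← he.norm_basis_eq (ψ 0) 0]
        simpa only [Int.cast_smul_eq_zsmul] using h2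
      -- There are `n` terms, each with coefficient of modulus `1 / n` and character norm at most `2
      -- λ(n)`.
      have h3 : ∑ j, ‖c j • blockSum e ψ (χ j)‖ ^ 2 ≤ (2 * r) ^ 2 := by
        have h4 : ∀ j, ‖c j • blockSum e ψ (χ j)‖ ^ 2 ≤
            ((Fintype.card G : ℝ)⁻¹ * (2 * fundamental e (Fintype.card G))) ^ 2 := fun j => by
          rw [norm_smul, hcn]
          gcongr
          exact he.norm_blockSum_character_le hψ (χ j)
        refine (Finset.sum_le_sum fun j _ => h4 j).trans (le_of_eq ?_)
        rw [Finset.sum_const, Finset.card_univ, hχ.card_eq, nsmul_eq_mul, hr, mul_pow, mul_pow,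
          mul_pow, div_pow, Real.sq_sqrt hn.le]
        field_simp
      have h5 : √(∑ j, ‖c j • blockSum e ψ (χ j)‖ ^ 2) ≤ 2 * r :=
        Real.sqrt_le_iff.2 ⟨by have := fundamental_nonneg (e := e) (Fintype.card G); positivity, h3⟩
      have h6 : α / C ≤ T * (2 * r) := h1.trans (by gcongr)
      rw [div_le_iff₀' hC0] at h6
      linarith
    rw [div_mul_eq_mul_div, div_le_iff₀ (by positivity)]
    calc α * √(∑ g, ‖a g‖ ^ 2) ≤ 2 * C * T * r * √(∑ g, ‖a g‖ ^ 2) := by gcongr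
      _ = 2 * C * T * (√(∑ g, ‖a g‖ ^ 2) * r) := by ring
      _ ≤ 2 * C * T * (192 * C * ‖blockSum e ψ a‖) := by gcongr
      _ = _ := by ring
  -- The basis itself is sign invariant, so type 2 gives the upper `ℓ₂` estimate directly.
  · have h := hT G (fun g => a g • e.basis (ψ g)) ‖blockSum e ψ a‖ fun ε => by
      rw [← he.norm_blockSum_units hψ a ε]
      simp [blockSum, mul_smul, ← Int.cast_smul_eq_zsmul 𝕜]
    refine h.trans (le_of_eq ?_)
    simp only [norm_smul, mul_pow, he.norm_basis_eq (ψ _) 0]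
    rw [← Finset.sum_mul, Real.sqrt_mul (Finset.sum_nonneg fun g _ => sq_nonneg _),
      Real.sqrt_sq (norm_nonneg _)]
    ring

end IsOneSymmetric

end

section

/-! ### Isomorphism with a Hilbert space -/

/-- The definition asks for a Hilbert space in the universe of `X`. Since `E` is in bijection with
`X`, it has a copy there, to which the inner product is transported. -/
theorem IsIsomorphicToHilbert.of_equiv {𝕜 : Type u} {X : Type v} [RCLike 𝕜]
    [NormedAddCommGroup X] [NormedSpace 𝕜 X] {E : Type*} [NormedAddCommGroup E]
    [InnerProductSpace 𝕜 E] [CompleteSpace E] (Φ : X ≃L[𝕜] E) : IsIsomorphicToHilbert 𝕜 X := by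
  have : Small.{v} E := small_of_injective Φ.symm.injective
  let f : Shrink.{v} E ≃ₗ[𝕜] E := Shrink.linearEquiv 𝕜 E
  have hf : ∀ x, ‖f x‖ = ‖x‖ := fun x => rfl
  let g : Shrink.{v} E ≃ₗᵢ[𝕜] E := ⟨f, hf⟩
  let iS : InnerProductSpace 𝕜 (Shrink.{v} E) :=
    { inner := fun x y => inner 𝕜 (f x) (f y)
      norm_sq_eq_re_inner := fun x => by rw [← hf]; exact norm_sq_eq_re_inner (f x)
      conj_inner_symm := fun x y => inner_conj_symm (f x) (f y)
      add_left := fun x y z => by rw [map_add, inner_add_left]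
      smul_left := fun x y r => by rw [map_smul, inner_smul_left] }
  have : CompleteSpace (Shrink.{v} E) :=
    (completeSpace_congr (e := g.toEquiv) g.isometry.isUniformEmbedding).2 inferInstance
  exact ⟨Shrink.{v} E, inferInstance, iS, this, ⟨Φ.trans g.symm.toContinuousLinearEquiv⟩⟩

open Filter Topology

namespace IsOneSymmetric

variable {𝕜 X : Type*} [RCLike 𝕜] [NormedAddCommGroup X] [NormedSpace 𝕜 X]
  {e : SchauderBasis 𝕜 X}

theorem sum_range_eq_blockSum (e : SchauderBasis 𝕜 X) (a : ℕ → 𝕜) (n : ℕ) :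
    ∑ i ∈ Finset.range n, a i • e.basis i =
      blockSum e (fun i : Fin n => (i : ℕ)) (fun i => a i) :=
  Finset.sum_range fun i => a i • e.basis i

theorem norm_sum_le_of_estimate {C : ℝ}
    (hC : ∀ (n : ℕ) (a : Fin n → 𝕜), ‖blockSum e (fun i : Fin n => (i : ℕ)) a‖ ≤
      C * √(∑ i, ‖a i‖ ^ 2)) (t : Finset ℕ) (a : ℕ → 𝕜) :
    ‖∑ i ∈ t, a i • e.basis i‖ ≤ C * √(∑ i ∈ t, ‖a i‖ ^ 2) := by
  obtain ⟨n, hn⟩ : ∃ n, t ⊆ Finset.range n := Finset.exists_nat_subset_range t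
  have h := hC n (fun i => if (i : ℕ) ∈ t then a i else 0)
  rw [← sum_range_eq_blockSum e (fun i => if i ∈ t then a i else 0),
    ← Finset.sum_range fun i => ‖if i ∈ t then a i else 0‖ ^ 2] at h
  rw [← Finset.sum_subset hn (fun i _ hi => by simp [hi]),
    ← Finset.sum_subset hn (fun i _ hi => by simp [hi])] at h
  rw [Finset.sum_congr rfl fun i hi => by rw [if_pos hi],
    Finset.sum_congr (g := fun i => ‖a i‖ ^ 2) rfl fun i hi => by rw [if_pos hi]] at h
  exact h

/-- The map is the coordinate map. The lower estimate on partial sums, with the basis constant `K`,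
makes it bounded; the upper estimate gives the Cauchy criterion for the series of a square summable
sequence, hence surjectivity. -/
theorem nonempty_equiv_lp [CompleteSpace X] (h : IsEquivalentToHilbertBasis e) :
    Nonempty (X ≃L[𝕜] lp (fun _ : ℕ => 𝕜) 2) := by
  obtain ⟨c, C, hc, h⟩ := h
  obtain ⟨K, hK⟩ := SchauderBasis.exists_norm_proj_le e
  have hK0 : 0 ≤ K := (norm_nonneg _).trans (hK 0)
  have two : (2 : ENNReal).toReal = ((2 : ℕ) : ℝ) := by simp
  have hbound : ∀ (x : X) (s : Finset ℕ), ∑ i ∈ s, ‖e.coord i x‖ ^ 2 ≤ (K / c * ‖x‖) ^ 2 := by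
    intro x s
    obtain ⟨n, hn⟩ : ∃ n, s ⊆ Finset.range n := Finset.exists_nat_subset_range s
    refine (Finset.sum_le_sum_of_subset_of_nonneg hn fun i _ _ => sq_nonneg _).trans ?_
    have h1 := (h n fun i => e.coord i x).1
    rw [← sum_range_eq_blockSum e (fun i => e.coord i x), ← SchauderBasis.proj_apply,
      ← Finset.sum_range fun i => ‖e.coord i x‖ ^ 2] at h1
    have h2 : √(∑ i ∈ Finset.range n, ‖e.coord i x‖ ^ 2) ≤ K / c * ‖x‖ := by
      rw [div_mul_eq_mul_div, le_div_iff₀' hc]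
      exact h1.trans ((e.proj n).le_of_opNorm_le (hK n) x)
    exact (Real.sqrt_le_left (by positivity)).1 h2
  let T₀ : X →ₗ[𝕜] lp (fun _ : ℕ => 𝕜) 2 :=
    { toFun := fun x => ⟨fun i => e.coord i x, memℓp_gen' (C := (K / c * ‖x‖) ^ 2) fun s => by
        simpa only [two, Real.rpow_natCast] using hbound x s⟩
      map_add' := fun x y => by
        ext i
        exact map_add (e.coord i) x y
      map_smul' := fun r x => by
        ext i
        exact map_smul (e.coord i) r x }
  let T : X →L[𝕜] lp (fun _ : ℕ => 𝕜) 2 := T₀.mkContinuous (K / c) fun x => by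
    refine lp.norm_le_of_forall_sum_le (by simp) (by positivity) fun s => ?_
    change ∑ i ∈ s, ‖e.coord i x‖ ^ _ ≤ _
    simpa only [two, Real.rpow_natCast] using hbound x s
  have hT : ∀ x i, T x i = e.coord i x := fun x i => rfl
  refine ⟨ContinuousLinearEquiv.ofBijective T ?_ ?_⟩
  · rw [LinearMap.ker_eq_bot']
    intro x hx
    have h0 : ∀ i, e.coord i x = 0 := fun i => by
      rw [← hT]
      simpa using congrArg (fun f : lp (fun _ : ℕ => 𝕜) 2 => f i) hx
    have := e.expansion x
    simp only [h0, zero_smul] at this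
    exact this.unique hasSum_zero
  · rw [LinearMap.range_eq_top]
    intro f
    have hsq : Summable fun i => ‖f i‖ ^ 2 := by
      have := (lp.memℓp f).summable (by simp)
      simpa only [two, Real.rpow_natCast] using this
    have hsum : Summable fun i => f i • e.basis i := by
      rw [summable_iff_vanishing_norm]
      intro ε hε
      have hC' : 0 < |C| + 1 := by positivity
      obtain ⟨s, hs⟩ := summable_iff_vanishing_norm.1 hsq ((ε / (|C| + 1)) ^ 2) (by positivity)
      refine ⟨s, fun t ht => ?_⟩
      have h1 := norm_sum_le_of_estimate (fun n a => (h n a).2) t (fun i => f i)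
      have h2 : √(∑ i ∈ t, ‖f i‖ ^ 2) < ε / (|C| + 1) := by
        rw [Real.sqrt_lt' (by positivity)]
        exact (le_abs_self _).trans_lt (hs t ht)
      calc _ ≤ _ := h1
        _ ≤ (|C| + 1) * √(∑ i ∈ t, ‖f i‖ ^ 2) := by
          gcongr
          linarith [le_abs_self C]
        _ < (|C| + 1) * (ε / (|C| + 1)) := by gcongr
        _ = ε := by field_simp
    refine ⟨∑' i, f i • e.basis i, ?_⟩
    ext i
    rw [ContinuousLinearMap.coe_coe, hT]
    have h3 := hsum.hasSum.mapL (e.coord i)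
    refine h3.unique ?_
    have h4 := hasSum_ite_eq i (f i)
    convert h4 using 2 with j
    rw [map_smul, e.ortho, smul_eq_mul]
    by_cases hij : j = i
    · subst hij
      simp
    · simp [hij, Ne.symm hij]

theorem isIsomorphicToHilbert [CompleteSpace X] (h : IsEquivalentToHilbertBasis e) :
    IsIsomorphicToHilbert 𝕜 X :=
  (nonempty_equiv_lp h).elim fun Φ => .of_equiv Φ

end IsOneSymmetric

end

section

/-! ### Cotype 2 -/

namespace IsOneSymmetric

variable {𝕜 X : Type*} [RCLike 𝕜] [NormedAddCommGroup X] [NormedSpace 𝕜 X]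
  {e : SchauderBasis 𝕜 X}

/-- Apply cotype 2 to `q = n / m` disjoint blocks of length `m`: every signed sum has norm `λ(q m) ≤
λ(n)`. The factor `2` under the root pays for `n ≤ 2 q m`. -/
theorem fundamental_le_of_hasCotypeTwo (he : IsOneSymmetric e) (h : HasCotypeTwo X) :
    ∃ T : ℝ, 0 < T ∧ ∀ m n : ℕ, 0 < m → m ≤ n →
      fundamental e m ≤ T * √(2 * m / n) * fundamental e n := by
  obtain ⟨T, hT0, hT⟩ := h.exists_le
  refine ⟨T, hT0, fun m n hm hmn => ?_⟩
  set q := n / m with hq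
  have hq1 : 1 ≤ q := (Nat.one_le_div_iff hm).2 hmn
  have hqm : q * m ≤ n := Nat.div_mul_le_self n m
  have hnq : n ≤ 2 * (q * m) := by
    have h1 : n < m * (n / m + 1) := Nat.lt_mul_div_succ n hm
    rw [← hq] at h1
    have : m ≤ q * m := Nat.le_mul_of_pos_left m hq1
    nlinarith
  let ψ : Fin q × Fin m → ℕ := fun p => finProdFinEquiv p
  have hψ : Function.Injective ψ := Fin.val_injective.comp finProdFinEquiv.injective
  let x : Fin q → X := fun i => blockSum e (fun l => ψ (i, l)) 1
  have hx : ∀ i, ‖x i‖ = fundamental e m := fun i => by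
    simpa using he.norm_blockSum_one (ψ := fun l => ψ (i, l))
      (hψ.comp (Prod.mk_right_injective i))
  have h1 := hT (Fin q) x (fundamental e n) fun ε => by
    have h2 : ‖blockSum e ψ (fun p => ((ε p.1 : ℤ) : 𝕜) * (1 : Fin q × Fin m → 𝕜) p)‖ =
        fundamental e (Fintype.card (Fin q × Fin m)) := by
      rw [he.norm_blockSum_units hψ 1 fun p => ε p.1]
      exact he.norm_blockSum_one hψ
    have h3 : blockSum e ψ (fun p => ((ε p.1 : ℤ) : 𝕜) * (1 : Fin q × Fin m → 𝕜) p) =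
        ∑ i, (ε i : ℤ) • x i := by
      simp only [blockSum, x, Fintype.sum_prod_type, Finset.smul_sum, Pi.one_apply, mul_one,
        one_smul, Int.cast_smul_eq_zsmul]
    rw [← h3, h2]
    refine he.fundamental_mono ?_
    simpa using hqm
  simp only [hx, Finset.sum_const, Finset.card_univ, Fintype.card_fin, nsmul_eq_mul] at h1
  rw [Real.sqrt_mul (by positivity), Real.sqrt_sq (fundamental_nonneg m)] at h1
  have hn0 : (0 : ℝ) < n := by exact_mod_cast hm.trans_le hmn
  have hm0 : (0 : ℝ) < m := by exact_mod_cast hm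
  have h4 : 1 ≤ √(2 * m / n) * √q := by
    rw [← Real.sqrt_mul (by positivity), Real.one_le_sqrt, div_mul_eq_mul_div, le_div_iff₀ hn0]
    have : (n : ℝ) ≤ 2 * (q * m) := by exact_mod_cast hnq
    linarith
  have h5 := fundamental_nonneg (e := e) m
  calc fundamental e m ≤ (√(2 * m / n) * √q) * fundamental e m := le_mul_of_one_le_left h5 h4
    _ = √(2 * m / n) * (√q * fundamental e m) := by ring
    _ ≤ √(2 * m / n) * (T * fundamental e n) := by gcongr
    _ = _ := by ring

theorem le_add_sum_dyadic {t s : ℝ} (I : ℕ) :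
    min t (2 ^ I * s) ≤ s + ∑ i ∈ Finset.range I, 2 ^ i * s * (if 2 ^ i * s < t then 1 else 0) := by
  induction I with
  | zero => simp
  | succ I ih =>
    rw [Finset.sum_range_succ, ← add_assoc]
    split_ifs with h
    · rw [min_eq_right h.le] at ih
      refine (min_le_right _ _).trans ?_
      rw [pow_succ]
      linarith
    · rw [min_eq_left (not_lt.1 h)] at ih
      refine (min_le_left _ _).trans ?_
      linarith

/-- Decompose `y` by the dyadic level sets `{2 ^ i s < ‖y‖}`. The fourth moment bounds their sizes
by `O(n 16⁻ⁱ)`, so by cotype 2 their indicators have norm `O(4⁻ⁱ λ(n))`; weighted by `2 ^ i s`,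
these sum geometrically. -/
theorem flatBound_of_hasCotypeTwo (he : IsOneSymmetric e) (h : HasCotypeTwo X) : FlatBound e := by
  classical
  obtain ⟨T, hT0, hT⟩ := he.fundamental_le_of_hasCotypeTwo h
  refine ⟨2 * (1 + 56 * T), by positivity, fun n y s hs hy => ?_⟩
  set ψ : Fin n → ℕ := fun i => i
  have hψ : Function.Injective ψ := Fin.val_injective
  have h4 := sum_pow_le_of_sum_exp_le (y := y) hs (by simpa using hy) 4
  rw [Fintype.card_fin] at h4
  -- the number of large coefficients
  have hcard : ∀ i : ℕ, fundamental e (Finset.univ.filter fun g => 2 ^ i * s < ‖y g‖).card ≤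
      28 * T * (1 / 4) ^ i * fundamental e n := by
    intro i
    set m := (Finset.univ.filter fun g => 2 ^ i * s < ‖y g‖).card with hm
    rcases Nat.eq_zero_or_pos m with h0 | h0
    · rw [h0]
      have : fundamental e 0 = 0 := by simp [fundamental, blockSum]
      rw [this]
      have := fundamental_nonneg (e := e) n
      positivity
    · have hmn : m ≤ n := (Finset.card_filter_le _ _).trans (by simp)
      have hn0 : (0 : ℝ) < n := by exact_mod_cast h0.trans_le hmn
      have h5 : (m : ℝ) * (2 ^ i * s) ^ 4 ≤ ∑ g, ‖y g‖ ^ 4 := by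
        rw [hm, ← nsmul_eq_mul, ← Finset.sum_const]
        refine (Finset.sum_le_sum fun g hg => ?_).trans
          (Finset.sum_le_sum_of_subset_of_nonneg (Finset.filter_subset _ _) fun _ _ _ => by
            positivity)
        have := (Finset.mem_filter.1 hg).2
        gcongr
      have h6 : (m : ℝ) * 16 ^ i ≤ 384 * n := by
        have h7 := h5.trans h4
        rw [mul_pow, ← mul_assoc, ← pow_mul, mul_comm i 4, pow_mul] at h7
        have := le_of_mul_le_mul_right h7 (by positivity)
        norm_num [Nat.factorial] at this
        exact this
      -- `384 = 16 · 4!`, and `2 · 384 = 768 ≤ 28²`.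
      have h8 : √(2 * m / n) ≤ 28 * (1 / 4) ^ i := by
        rw [Real.sqrt_le_left (by positivity), div_le_iff₀ hn0, mul_pow, ← pow_mul, mul_comm i 2,
          pow_mul, show ((1 : ℝ) / 4) ^ 2 = 1 / 16 by norm_num, one_div_pow]
        have h16 : (0 : ℝ) < 16 ^ i := by positivity
        rw [mul_one_div, div_mul_eq_mul_div, le_div_iff₀ h16]
        nlinarith
      refine (hT m n h0 hmn).trans ?_
      have := fundamental_nonneg (e := e) n
      calc _ ≤ T * (28 * (1 / 4) ^ i) * fundamental e n := by gcongr
        _ = _ := by ring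
  obtain ⟨I, hI⟩ : ∃ I : ℕ, ∀ g, ‖y g‖ ≤ 2 ^ I * s := by
    obtain ⟨I, hI⟩ := pow_unbounded_of_one_lt ((∑ g, ‖y g‖) / s) one_lt_two
    refine ⟨I, fun g => ?_⟩
    rw [div_lt_iff₀ hs] at hI
    exact (Finset.single_le_sum (fun g _ => norm_nonneg (y g)) (Finset.mem_univ g)).trans hI.le
  let ind : ℕ → Fin n → 𝕜 := fun i g => if 2 ^ i * s < ‖y g‖ then 1 else 0
  -- A step function dominating `‖y‖` pointwise; domination costs a factor `2` in norm.
  let b : Fin n → 𝕜 := (s : 𝕜) • 1 + ∑ i ∈ Finset.range I, ((2 ^ i * s : ℝ) : 𝕜) • ind i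
  have hyb : ∀ g, ‖y g‖ ≤ ‖b g‖ := by
    intro g
    have h9 := le_add_sum_dyadic (t := ‖y g‖) (s := s) I
    rw [min_eq_left (hI g)] at h9
    have h10 : b g = ((s + ∑ i ∈ Finset.range I,
        2 ^ i * s * (if 2 ^ i * s < ‖y g‖ then 1 else 0) : ℝ) : 𝕜) := by
      simp only [b, ind, Pi.add_apply, Pi.smul_apply, Pi.one_apply, Finset.sum_apply, smul_eq_mul,
        mul_one, RCLike.ofReal_add, RCLike.ofReal_sum]
      congr 1
      refine Finset.sum_congr rfl fun i _ => ?_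
      split_ifs <;> simp only [mul_one, mul_zero, RCLike.ofReal_zero]
    rw [h10, RCLike.norm_ofReal]
    exact h9.trans (le_abs_self _)
  have hlam := fundamental_nonneg (e := e) n
  have hb : ‖blockSum e ψ b‖ ≤ (1 + 56 * T) * s * fundamental e n := by
    have h11 : ∀ i, ‖blockSum e ψ (((2 ^ i * s : ℝ) : 𝕜) • ind i)‖ ≤
        28 * T * s * fundamental e n * (1 / 2) ^ i := fun i => by
      rw [blockSum_smul, norm_smul, he.norm_blockSum_indicator hψ, RCLike.norm_ofReal,
        abs_of_pos (by positivity)]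
      calc _ ≤ 2 ^ i * s * (28 * T * (1 / 4) ^ i * fundamental e n) := by
            gcongr
            exact hcard i
        _ = 28 * T * s * fundamental e n * (2 ^ i * (1 / 4) ^ i) := by ring
        _ = _ := by
            rw [← mul_pow]
            norm_num
    have hgeo : ∑ i ∈ Finset.range I, ((1 : ℝ) / 2) ^ i ≤ 2 := by
      have := sum_geometric_two_le I
      simpa using this
    rw [blockSum_add, blockSum_sum]
    refine (norm_add_le _ _).trans ?_
    have h12 : ‖blockSum e ψ ((s : 𝕜) • 1)‖ = s * fundamental e n := by
      rw [blockSum_smul, norm_smul, he.norm_blockSum_one hψ, RCLike.norm_ofReal, abs_of_pos hs,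
        Fintype.card_fin]
    rw [h12]
    have h13 := (norm_sum_le _ _).trans (Finset.sum_le_sum fun i (_ : i ∈ Finset.range I) => h11 i)
    rw [← Finset.mul_sum] at h13
    have h14 : 28 * T * s * fundamental e n * ∑ i ∈ Finset.range I, ((1 : ℝ) / 2) ^ i ≤
        28 * T * s * fundamental e n * 2 := by gcongr
    linarith
  have := he.norm_blockSum_le_two_mul hψ hyb
  linarith

end IsOneSymmetric

end

section

/-! ### Systems of characters on consecutive blocks -/

namespace IsOneSymmetric

open Filter Topology ComplexConjugate

variable {𝕜 X : Type*} [RCLike 𝕜] [NormedAddCommGroup X] [NormedSpace 𝕜 X]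
  {e : SchauderBasis 𝕜 X}

/-- Restriction to finitely many coordinates multiplies the coefficients by `0` or `1`, so it is
contractive on each long partial sum; then pass to the limit. -/
theorem norm_blockSum_coord_le (he : IsOneSymmetric e) {ι : Type*} [Fintype ι] {ψ : ι → ℕ}
    (hψ : Function.Injective ψ) (x : X) :
    ‖blockSum e ψ (fun i => e.coord (ψ i) x)‖ ≤ ‖x‖ := by
  classical
  refine ge_of_tendsto (SchauderBasis.tendsto_proj e x).norm ?_
  obtain ⟨N, hN⟩ : ∃ N, Finset.univ.image ψ ⊆ Finset.range N := Finset.exists_nat_subset_range _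
  filter_upwards [eventually_ge_atTop N] with n hn
  have h := he.norm_blockSum_mul_real_le (ψ := fun i : Fin n => (i : ℕ)) Fin.val_injective
    (fun i => e.coord i x) (fun i => if (i : ℕ) ∈ Finset.univ.image ψ then 1 else 0)
    (fun i => by split_ifs <;> simp)
  rw [← sum_range_eq_blockSum e (fun i => e.coord i x), ← SchauderBasis.proj_apply,
    ← sum_range_eq_blockSum e
      (fun i => ((if i ∈ Finset.univ.image ψ then 1 else 0 : ℝ) : 𝕜) * e.coord i x),
    ← Finset.sum_subset (hN.trans (Finset.range_subset_range.2 hn)) (fun i _ hi => by simp [hi]),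
    Finset.sum_image hψ.injOn] at h
  refine le_trans (le_of_eq ?_) h
  simp [blockSum]

theorem mem_closure_span_range (e : SchauderBasis 𝕜 X) (x : X) :
    x ∈ (Submodule.span 𝕜 (Set.range e.basis)).topologicalClosure := by
  refine mem_closure_of_tendsto (SchauderBasis.tendsto_proj e x) (Eventually.of_forall fun n => ?_)
  rw [SchauderBasis.proj_apply]
  exact Submodule.sum_mem _ fun i _ => Submodule.smul_mem _ _ (Submodule.subset_span ⟨i, rfl⟩)

theorem eq_zero_of_coord_eq_zero (e : SchauderBasis 𝕜 X) {x : X} (h : ∀ i, e.coord i x = 0) :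
    x = 0 := by
  have := e.expansion x
  simp only [h, zero_smul] at this
  exact this.unique hasSum_zero

theorem block_injective {G : ℕ → Type} (φ : (Σ k, G k) ≃ ℕ) (k : ℕ) :
    Function.Injective fun g : G k => φ ⟨k, g⟩ :=
  φ.injective.comp sigma_mk_injective

variable {G J : ℕ → Type} [∀ k, AddCommGroup (G k)] [∀ k, Fintype (G k)]

/-- The vector of a character on a block. -/
def blockVector (e : SchauderBasis 𝕜 X) (φ : (Σ k, G k) ≃ ℕ) (χ : ∀ k, J k → AddChar (G k) 𝕜)
    (p : Σ k, J k) : X :=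
  blockSum e (fun g => φ ⟨p.1, g⟩) (χ p.1 p.2)

/-- The system of all normalized vectors of characters. -/
def blockSystem (e : SchauderBasis 𝕜 X) (φ : (Σ k, G k) ≃ ℕ) (χ : ∀ k, J k → AddChar (G k) 𝕜)
    (p : Σ k, J k) : X :=
  ((‖blockVector e φ χ p‖⁻¹ : ℝ) : 𝕜) • blockVector e φ χ p

/-- The functionals biorthogonal to `blockSystem`. -/
def blockFunctional (e : SchauderBasis 𝕜 X) (φ : (Σ k, G k) ≃ ℕ)
    (χ : ∀ k, J k → AddChar (G k) 𝕜) (p : Σ k, J k) : StrongDual 𝕜 X :=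
  ((‖blockVector e φ χ p‖ : 𝕜) * (Fintype.card (G p.1) : 𝕜)⁻¹) •
    ∑ g, conj (χ p.1 p.2 g) • e.coord (φ ⟨p.1, g⟩)

variable {φ : (Σ k, G k) ≃ ℕ} {χ : ∀ k, J k → AddChar (G k) 𝕜}

theorem blockVector_norm_pos (p : Σ k, J k) : 0 < ‖blockVector e φ χ p‖ :=
  norm_blockSum_character_pos (block_injective φ p.1) _

theorem smul_blockSystem (p : Σ k, J k) :
    (‖blockVector e φ χ p‖ : 𝕜) • blockSystem e φ χ p = blockVector e φ χ p := by
  rw [blockSystem, smul_smul, ← RCLike.ofReal_mul,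
    mul_inv_cancel₀ (blockVector_norm_pos p).ne', RCLike.ofReal_one, one_smul]

theorem blockFunctional_apply (p : Σ k, J k) (x : X) :
    blockFunctional e φ χ p x = (‖blockVector e φ χ p‖ : 𝕜) *
      charCoeff (χ p.1 p.2) (fun g => e.coord (φ ⟨p.1, g⟩) x) := by
  simp [blockFunctional, charCoeff, mul_assoc]

variable [∀ k, Fintype (J k)]

theorem charCoeff_blockVector (hχ : ∀ k, IsCompleteCharacterFamily (χ k)) (p q : Σ k, J k) :
    (p = q → charCoeff (χ p.1 p.2) (fun g => e.coord (φ ⟨p.1, g⟩) (blockVector e φ χ q)) = 1) ∧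
    (p ≠ q → charCoeff (χ p.1 p.2) (fun g => e.coord (φ ⟨p.1, g⟩) (blockVector e φ χ q)) = 0) := by
  classical
  obtain ⟨k, i⟩ := p
  obtain ⟨l, j⟩ := q
  rcases eq_or_ne k l with rfl | hkl
  · simp only [blockVector, coord_blockSum (block_injective φ k)]
    constructor
    · intro h
      obtain rfl : i = j := by simpa using h
      exact IsCompleteCharacterFamily.charCoeff_self _
    · intro h
      exact (hχ k).charCoeff_ne fun hij => h (by rw [hij])
  · refine ⟨fun h => absurd (congrArg Sigma.fst h) hkl, fun _ => ?_⟩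
    have h0 : ∀ g, e.coord (φ ⟨k, g⟩) (blockVector e φ χ ⟨l, j⟩) = 0 := fun g => by
      simp only [blockVector, blockSum, map_sum, map_smul, e.ortho]
      refine Finset.sum_eq_zero fun h _ => ?_
      have : φ ⟨k, g⟩ ≠ φ ⟨l, h⟩ := fun hh => hkl (congrArg Sigma.fst (φ.injective hh))
      simp [this]
    simp [charCoeff, h0]

theorem basis_mem_span_blockSystem (hχ : ∀ k, IsCompleteCharacterFamily (χ k)) (i : ℕ) :
    e.basis i ∈ Submodule.span 𝕜 (Set.range (blockSystem e φ χ)) := by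
  classical
  obtain ⟨⟨k, g⟩, rfl⟩ := φ.surjective i
  rw [← blockSum_single (e := e) (fun g => φ ⟨k, g⟩) g, blockSum_eq_sum_charCoeff (hχ k)]
  refine Submodule.sum_mem _ fun j _ => Submodule.smul_mem _ _ ?_
  have h := smul_blockSystem (e := e) (φ := φ) (χ := χ) ⟨k, j⟩
  rw [blockVector] at h
  rw [← h]
  exact Submodule.smul_mem _ _ (Submodule.subset_span ⟨_, rfl⟩)

/-- Density and totality hold because on each block the characters span all coefficient vectors. The
functionals have norm at most `1` since both restriction to a block and projection onto a character
are contractive. -/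
theorem isAuerbachBasis_blockSystem (he : IsOneSymmetric e)
    (hχ : ∀ k, IsCompleteCharacterFamily (χ k)) :
    IsAuerbachBasis 𝕜 (blockSystem e φ χ) (blockFunctional e φ χ) := by
  have hself : ∀ p, blockFunctional e φ χ p (blockSystem e φ χ p) = 1 := fun p => by
    have h := blockFunctional_apply (e := e) (φ := φ) (χ := χ) p (blockVector e φ χ p)
    rw [(charCoeff_blockVector hχ p p).1 rfl, mul_one] at h
    rw [blockSystem, map_smul, h, smul_eq_mul, ← RCLike.ofReal_mul,
      inv_mul_cancel₀ (blockVector_norm_pos p).ne', RCLike.ofReal_one]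
  have hnorm : ∀ p, ‖blockSystem e φ χ p‖ = 1 := fun p => by
    rw [blockSystem, norm_smul, RCLike.norm_ofReal, abs_of_pos (inv_pos.2 (blockVector_norm_pos p)),
      inv_mul_cancel₀ (blockVector_norm_pos p).ne']
  refine ⟨⟨hself, fun p q hpq => ?_, ?_, fun y hy => ?_⟩, hnorm, fun p => le_antisymm ?_ ?_⟩
  · rw [blockSystem, map_smul, blockFunctional_apply, (charCoeff_blockVector hχ p q).2 hpq,
      mul_zero, smul_zero]
  · rw [eq_top_iff]
    intro x _
    refine Submodule.topologicalClosure_mono (Submodule.span_le.2 ?_) (mem_closure_span_range e x)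
    rintro _ ⟨i, rfl⟩
    exact basis_mem_span_blockSystem hχ i
  · refine eq_zero_of_coord_eq_zero e fun i => ?_
    obtain ⟨⟨k, g⟩, rfl⟩ := φ.surjective i
    have h := congrFun ((hχ k).sum_charCoeff_mul fun g => e.coord (φ ⟨k, g⟩) y) g
    rw [← h]
    simp only [Finset.sum_apply, Pi.smul_apply, smul_eq_mul]
    refine Finset.sum_eq_zero fun j _ => ?_
    have h1 := hy ⟨k, j⟩
    rw [blockFunctional_apply, mul_eq_zero] at h1
    rw [h1.resolve_left (by exact_mod_cast (blockVector_norm_pos _).ne'), zero_mul]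
  · refine ContinuousLinearMap.opNorm_le_bound _ zero_le_one fun x => ?_
    rw [blockFunctional_apply, norm_mul, RCLike.norm_ofReal, abs_norm, mul_comm, one_mul]
    exact (he.norm_charCoeff_mul_le (block_injective φ p.1) _ _).trans
      (he.norm_blockSum_coord_le (block_injective φ p.1) x)
  · have h := (blockFunctional e φ χ p).le_opNorm (blockSystem e φ χ p)
    rwa [hself, hnorm, norm_one, mul_one] at h

/-- On the span of one block, a sign change is `2 P - 1`, where `P` is the basis projection onto the
indices with sign `+1`; these projections are uniformly bounded. -/
theorem signBound_of_unconditional [CompleteSpace X]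
    (h : IsUnconditionalSchauderBasis 𝕜 (blockSystem e φ χ)) :
    ∃ C : ℝ, 0 < C ∧ ∀ k, SignBound e (fun g => φ ⟨k, g⟩) (χ k) C := by
  classical
  obtain ⟨b, hb⟩ := h
  obtain ⟨K, hK⟩ := UnconditionalSchauderBasis.exists_norm_proj_le b
  have hK0 : 0 ≤ K := (norm_nonneg _).trans (hK ∅)
  refine ⟨2 * K + 1, by positivity, fun k c ε => ?_⟩
  set V : J k → X := fun j => blockSum e (fun g => φ ⟨k, g⟩) (χ k j) with hV
  set z := ∑ j, c j • V j with hz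
  let A : Finset (Σ k, J k) :=
    (Finset.univ.filter fun j => ε j = 1).map ⟨fun j => ⟨k, j⟩, sigma_mk_injective⟩
  have hproj : ∀ j, b.proj A (V j) = if ε j = 1 then V j else 0 := fun j => by
    have h1 : V j = (‖blockVector e φ χ ⟨k, j⟩‖ : 𝕜) • b.basis ⟨k, j⟩ := by
      rw [hb, smul_blockSystem]
      rfl
    rw [h1, map_smul, b.proj_apply_basis_mem]
    have h2 : (⟨k, j⟩ : Σ k, J k) ∈ A ↔ ε j = 1 := by simp [A]
    simp only [h2]
    split_ifs <;> simp
  have hsum : ∑ j, ((ε j : ℤ) : 𝕜) • c j • V j = (2 : 𝕜) • b.proj A z - z := by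
    rw [hz, map_sum, Finset.smul_sum, ← Finset.sum_sub_distrib]
    refine Finset.sum_congr rfl fun j _ => ?_
    rw [map_smul, hproj]
    rcases Int.units_eq_one_or (ε j) with h | h
    · simp [h, two_smul]
    · have : (-1 : ℤˣ) ≠ 1 := by decide
      simp [h, this]
  rw [hsum]
  calc ‖(2 : 𝕜) • b.proj A z - z‖ ≤ ‖(2 : 𝕜) • b.proj A z‖ + ‖z‖ := norm_sub_le _ _
    _ ≤ 2 * (K * ‖z‖) + ‖z‖ := by
        rw [norm_smul, RCLike.norm_ofNat]
        gcongr
        exact (b.proj A).le_of_opNorm_le (hK A) z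
    _ = _ := by ring

/-- In a space with a 1-symmetric basis in which unconditionality of characters forces `ℓ₂`
estimates, the system of characters is a conditional Auerbach basis unless the space is
isomorphic to a Hilbert space. -/
theorem isNonUnconditionalAuerbach_blockSystem [CompleteSpace X] (he : IsOneSymmetric e)
    (hχ : ∀ k, IsCompleteCharacterFamily (χ k)) (hcard : ∀ m, ∃ k, m ≤ Fintype.card (G k))
    (hcrit : HasUnconditionalCharacterBlocks e → IsEquivalentToHilbertBasis e)
    (hX : ¬ IsIsomorphicToHilbert 𝕜 X) :
    IsNonUnconditionalAuerbach 𝕜 (blockSystem e φ χ) := by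
  refine ⟨⟨_, he.isAuerbachBasis_blockSystem hχ⟩, fun h => hX ?_⟩
  obtain ⟨C, hC0, hC⟩ := signBound_of_unconditional h
  refine isIsomorphicToHilbert (hcrit ⟨C, hC0, fun m => ?_⟩)
  obtain ⟨k, hk⟩ := hcard m
  exact ⟨G k, J k, inferInstance, inferInstance, inferInstance, _, χ k, hk, block_injective φ k,
    hχ k, hC k⟩

theorem _root_.IsNonUnconditionalAuerbach.comp_equiv {ι κ : Type*} {x : ι → X} (σ : κ ≃ ι)
    (h : IsNonUnconditionalAuerbach 𝕜 x) : IsNonUnconditionalAuerbach 𝕜 (x ∘ σ) := by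
  classical
  obtain ⟨⟨f, hf⟩, hx⟩ := h
  refine ⟨⟨f ∘ σ, ⟨fun i => hf.apply_self _, fun i j hij => hf.apply_ne _ _ (σ.injective.ne hij),
    ?_, fun y hy => hf.total y fun i => ?_⟩, fun i => hf.norm_vector _,
    fun i => hf.norm_functional _⟩, fun ⟨b, hb⟩ => hx ⟨⟨b.basis ∘ σ.symm, b.coord ∘ σ.symm,
      fun i j => ?_, fun y => ?_⟩, ?_⟩⟩
  · rw [σ.surjective.range_comp]
    exact hf.fundamental
  · simpa using hy (σ.symm i)
  · have := b.ortho (σ.symm i) (σ.symm j)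
    simpa [Pi.single_apply] using this
  · exact (σ.symm.hasSum_iff (f := fun i => b.coord i y • b.basis i)).2 (b.expansion y)
  · funext i
    simpa using congrFun hb (σ.symm i)

theorem hasUnconditionalCharacterBlocks_imp (he : IsOneSymmetric e)
    (h : HasTypeTwo X ∨ HasCotypeTwo X) (hblocks : HasUnconditionalCharacterBlocks e) :
    IsEquivalentToHilbertBasis e :=
  h.elim (fun h => he.isEquivalentToHilbertBasis_of_hasTypeTwo h hblocks)
    fun h => he.isEquivalentToHilbertBasis_of_flatBound (he.flatBound_of_hasCotypeTwo h) hblocks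

end IsOneSymmetric

end

section

/-! ### Walsh functions and characters of cyclic groups -/

open ComplexConjugate

section Walsh

variable (𝕜 : Type*) [RCLike 𝕜]

/-- The sign `(-1) ^ (x y)`. -/
def walshSign (x y : ZMod 2) : 𝕜 := if x * y = 0 then 1 else -1

variable {𝕜}

theorem ZMod.two_cases (x : ZMod 2) : x = 0 ∨ x = 1 := by
  revert x
  decide

theorem walshSign_add (x y z : ZMod 2) :
    walshSign 𝕜 x (y + z) = walshSign 𝕜 x y * walshSign 𝕜 x z := by
  have h2 : (1 : ZMod 2) + 1 = 0 := by decide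
  rcases ZMod.two_cases x with rfl | rfl <;> rcases ZMod.two_cases y with rfl | rfl <;>
    rcases ZMod.two_cases z with rfl | rfl <;> simp [walshSign, h2]

theorem walshSign_comm (x y : ZMod 2) : walshSign 𝕜 x y = walshSign 𝕜 y x := by
  simp [walshSign, mul_comm x y]

theorem conj_walshSign (x y : ZMod 2) : conj (walshSign 𝕜 x y) = walshSign 𝕜 x y := by
  unfold walshSign
  split_ifs <;> simp

theorem sum_walshSign {y z : ZMod 2} (h : y ≠ z) :
    ∑ x, walshSign 𝕜 x y * walshSign 𝕜 x z = 0 := by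
  rw [show (Finset.univ : Finset (ZMod 2)) = {0, 1} from rfl, Finset.sum_pair (by decide)]
  rcases ZMod.two_cases y with rfl | rfl <;> rcases ZMod.two_cases z with rfl | rfl <;>
    simp_all [walshSign]

/-- The Walsh function `g ↦ (-1) ^ (u · g)` on `(ℤ / 2) ^ k`. -/
def walshCharacter (𝕜 : Type*) [RCLike 𝕜] {k : ℕ} (u : Fin k → ZMod 2) :
    AddChar (Fin k → ZMod 2) 𝕜 where
  toFun g := ∏ i, walshSign 𝕜 (u i) (g i)
  map_zero_eq_one' := by simp [walshSign]
  map_add_eq_mul' g h := by simp [walshSign_add, Finset.prod_mul_distrib]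

theorem walshCharacter_apply {k : ℕ} (u g : Fin k → ZMod 2) :
    walshCharacter 𝕜 u g = ∏ i, walshSign 𝕜 (u i) (g i) := rfl

theorem sum_walshCharacter {k : ℕ} {g h : Fin k → ZMod 2} (hgh : g ≠ h) :
    ∑ u : Fin k → ZMod 2, conj (walshCharacter 𝕜 u g) * walshCharacter 𝕜 u h = 0 := by
  obtain ⟨i, hi⟩ := Function.ne_iff.1 hgh
  simp only [walshCharacter_apply, map_prod, conj_walshSign, ← Finset.prod_mul_distrib]
  have h1 := Finset.prod_univ_sum (fun _ : Fin k => (Finset.univ : Finset (ZMod 2)))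
    (fun j x => walshSign 𝕜 x (g j) * walshSign 𝕜 x (h j))
  rw [Fintype.piFinset_univ] at h1
  rw [← h1]
  -- The sum over `u` factors over coordinates, and the factor at a coordinate where `g` and `h`
  -- differ vanishes.
  exact Finset.prod_eq_zero (Finset.mem_univ i) (sum_walshSign hi)

theorem isCompleteCharacterFamily_walsh (𝕜 : Type*) [RCLike 𝕜] (k : ℕ) :
    IsCompleteCharacterFamily (walshCharacter 𝕜 : (Fin k → ZMod 2) → _) where
  orthogonal u w h := by
    rw [← sum_walshCharacter (𝕜 := 𝕜) h]
    simp only [walshCharacter_apply]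
    refine Finset.sum_congr rfl fun g _ => ?_
    simp only [walshSign_comm (g _)]
  dual g h hgh := sum_walshCharacter hgh
  card_eq := rfl

end Walsh

theorem isCompleteCharacterFamily_addChar (G : Type) [AddCommGroup G] [Fintype G] :
    IsCompleteCharacterFamily (fun χ : AddChar G ℂ => χ) where
  orthogonal χ η h := by
    classical
    have h1 := AddChar.sum_eq_ite (χ⁻¹ * η)
    rw [if_neg (by
      intro h0
      have h2 : χ⁻¹ * η = 1 := h0
      exact h (inv_mul_eq_one.1 h2))] at h1
    rw [← h1]
    refine Finset.sum_congr rfl fun g _ => ?_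
    rw [AddChar.mul_apply, AddChar.inv_apply, AddChar.map_neg_eq_conj]
  dual g h hgh := by
    classical
    have h1 := AddChar.sum_apply_eq_ite (h - g)
    rw [if_neg (sub_ne_zero.2 hgh.symm)] at h1
    rw [← h1]
    refine Finset.sum_congr rfl fun χ _ => ?_
    rw [sub_eq_add_neg, AddChar.map_add_eq_mul, AddChar.map_neg_eq_conj, mul_comm]
  card_eq := AddChar.card_eq

section Cyclic

variable {n : ℕ → ℕ}

/-- Consecutive blocks of lengths `n k` partition `ℕ`. -/
theorem bijective_sum_add_val [∀ k, NeZero (n k)] :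
    Function.Bijective fun p : Σ k, ZMod (n k) => (∑ i ∈ Finset.range p.1, n i) + p.2.val := by
  have hmono : Monotone fun k => ∑ i ∈ Finset.range k, n i := fun a b hab =>
    Finset.sum_le_sum_of_subset (Finset.range_subset_range.2 hab)
  constructor
  · rintro ⟨k, g⟩ ⟨l, h⟩ hgh
    simp only at hgh
    have key : ∀ {k l : ℕ} (g : ZMod (n k)) (h : ZMod (n l)), k < l →
        (∑ i ∈ Finset.range k, n i) + g.val < (∑ i ∈ Finset.range l, n i) + h.val := by
      intro k l g h hkl
      have h1 := hmono (Nat.succ_le_of_lt hkl)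
      simp only [Nat.succ_eq_add_one, Finset.sum_range_succ] at h1
      have := ZMod.val_lt g
      omega
    rcases lt_trichotomy k l with hkl | rfl | hkl
    · exact absurd hgh (key g h hkl).ne
    · rw [ZMod.val_injective _ (Nat.add_left_cancel hgh)]
    · exact absurd hgh (key h g hkl).ne'
  · intro m
    have hex : ∃ k, m < ∑ i ∈ Finset.range (k + 1), n i := by
      refine ⟨m, ?_⟩
      have : ∑ _i ∈ Finset.range (m + 1), 1 ≤ ∑ i ∈ Finset.range (m + 1), n i :=
        Finset.sum_le_sum fun i _ => Nat.one_le_iff_ne_zero.2 (NeZero.ne (n i))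
      simp only [Finset.sum_const, Finset.card_range, smul_eq_mul, mul_one] at this
      omega
    classical
    set k := Nat.find hex with hk
    have h1 : m < ∑ i ∈ Finset.range (k + 1), n i := Nat.find_spec hex
    have h2 : ∑ i ∈ Finset.range k, n i ≤ m := by
      rcases Nat.eq_zero_or_pos k with h0 | h0
      · simp [h0]
      · have := Nat.find_min hex (Nat.sub_lt h0 one_pos)
        rw [← hk, Nat.sub_add_cancel (show 1 ≤ k from h0)] at this
        exact not_lt.1 this
    rw [Finset.sum_range_succ] at h1
    refine ⟨⟨k, ((m - ∑ i ∈ Finset.range k, n i : ℕ) : ZMod (n k))⟩, ?_⟩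
    simp only
    rw [ZMod.val_natCast_of_lt (by omega)]
    omega

/-- The positions of the consecutive blocks of lengths `n k`. -/
def cyclicBlocks (n : ℕ → ℕ) [∀ k, NeZero (n k)] : (Σ k, ZMod (n k)) ≃ ℕ :=
  Equiv.ofBijective _ bijective_sum_add_val

variable {X : Type*} [NormedAddCommGroup X] [NormedSpace ℂ X]

theorem blockSystem_cyclicBlocks [∀ k, NeZero (n k)] (e : SchauderBasis ℂ X) :
    IsOneSymmetric.blockSystem e (cyclicBlocks n) (fun _ χ => χ) =
      characterSystem e.basis n := by
  have h : IsOneSymmetric.blockVector e (cyclicBlocks n) (fun _ χ => χ) =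
      characterVector e.basis n := by
    funext p
    simp only [IsOneSymmetric.blockVector, IsOneSymmetric.blockSum, characterVector, cyclicBlocks,
      Equiv.ofBijective_apply]
    refine Finset.sum_nbij' (fun g => g.val) (fun l => (l : ZMod (n p.1))) ?_ ?_ ?_ ?_ ?_
    · intro g _
      exact Finset.mem_range.2 (ZMod.val_lt g)
    · simp
    · intro g _
      exact ZMod.natCast_zmod_val g
    · intro l hl
      exact ZMod.val_natCast_of_lt (Finset.mem_range.1 hl)
    · intro g _
      rw [ZMod.natCast_zmod_val]
  funext p
  simp only [IsOneSymmetric.blockSystem, h, characterSystem]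
  rfl

end Cyclic

/-! ### Conditional Auerbach bases -/

namespace IsOneSymmetric

/-- Walsh functions take the values `±1`, so they are available over both scalar fields. They are
labelled by the elements of their group, so one bijection `φ` places the blocks and also reindexes
the system by `ℕ`. -/
theorem exists_isNonUnconditionalAuerbach {𝕜 X : Type*} [RCLike 𝕜] [NormedAddCommGroup X]
    [NormedSpace 𝕜 X] [CompleteSpace X] {e : SchauderBasis 𝕜 X} (he : IsOneSymmetric e)
    (hcrit : HasUnconditionalCharacterBlocks e → IsEquivalentToHilbertBasis e)
    (hX : ¬ IsIsomorphicToHilbert 𝕜 X) : ∃ x : ℕ → X, IsNonUnconditionalAuerbach 𝕜 x := by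
  have hinf : Infinite (Σ k, Fin k → ZMod 2) :=
    Infinite.of_injective (fun k => ⟨k, 0⟩) fun a b h => congrArg Sigma.fst h
  obtain ⟨φ⟩ : Nonempty ((Σ k, Fin k → ZMod 2) ≃ ℕ) := nonempty_equiv_of_countable
  have h := he.isNonUnconditionalAuerbach_blockSystem (φ := φ) (χ := fun _ => walshCharacter 𝕜)
    (fun k => isCompleteCharacterFamily_walsh 𝕜 k)
    (fun m => ⟨m, by simpa using Nat.lt_two_pow_self.le⟩) hcrit hX
  exact ⟨_, h.comp_equiv φ.symm⟩

theorem isNonUnconditionalAuerbach_characterSystem {X : Type*} [NormedAddCommGroup X]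
    [NormedSpace ℂ X] [CompleteSpace X] {e : SchauderBasis ℂ X} (he : IsOneSymmetric e)
    (hcrit : HasUnconditionalCharacterBlocks e → IsEquivalentToHilbertBasis e)
    (hX : ¬ IsIsomorphicToHilbert ℂ X) {n : ℕ → ℕ} (hn : StrictMono n) (hn0 : 0 < n 0) :
    IsNonUnconditionalAuerbach ℂ (characterSystem e.basis n) := by
  have : ∀ k, NeZero (n k) := fun k =>
    ⟨(hn0.trans_le (hn.monotone (Nat.zero_le k))).ne'⟩
  rw [← blockSystem_cyclicBlocks]
  refine he.isNonUnconditionalAuerbach_blockSystem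
    (fun k => isCompleteCharacterFamily_addChar (ZMod (n k))) (fun m => ⟨m, ?_⟩) hcrit hX
  rw [ZMod.card]
  exact hn.le_apply

end IsOneSymmetric

end

section

/-! ### Orlicz sequence spaces -/

namespace OrliczFunction

open Filter Topology

variable {𝕜 : Type*} [RCLike 𝕜] {M : OrliczFunction}

theorem mono_of_nonneg (M : OrliczFunction) {a b : ℝ} (ha : 0 ≤ a) (hab : a ≤ b) :
    M.toFun a ≤ M.toFun b :=
  M.mono (Set.mem_Ici.2 ha) (Set.mem_Ici.2 (ha.trans hab)) hab

theorem Admissible.of_le {x : ℕ → 𝕜} {a b : ℝ} (h : M.Admissible x a) (hab : a ≤ b) :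
    M.Admissible x b := by
  rw [admissible_iff] at *
  have hb := h.1.trans_le hab
  have ha := h.1
  refine ⟨hb, fun s => (Finset.sum_le_sum fun i _ => ?_).trans (h.2 s)⟩
  exact M.mono_of_nonneg (by positivity) (by gcongr)

theorem exists_one_lt (M : OrliczFunction) : ∃ T, 0 < T ∧ 1 < M.toFun T :=
  ((eventually_gt_atTop 0).and (M.unbounded.eventually_gt_atTop 1)).exists

theorem tendsto_comp (M : OrliczFunction) {α : Type*} {l : Filter α} {f : α → ℝ} {a : ℝ}
    (ha : 0 ≤ a) (hf : Tendsto f l (𝓝 a)) (hf0 : ∀ᶠ i in l, 0 ≤ f i) :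
    Tendsto (fun i => M.toFun (f i)) l (𝓝 (M.toFun a)) :=
  (M.cont a ha).tendsto.comp (tendsto_nhdsWithin_iff.2 ⟨hf, hf0⟩)

/-- The `Δ₂` condition at zero holds on every bounded interval. -/
theorem DeltaTwoAtZero.exists_le (h : M.DeltaTwoAtZero) (R : ℝ) :
    ∃ K : ℝ, 1 ≤ K ∧ ∀ t, 0 < t → t ≤ R → M.toFun (2 * t) ≤ K * M.toFun t := by
  obtain ⟨K, t₀, ht₀, hK⟩ := h
  have hM := M.pos t₀ ht₀
  refine ⟨max 1 (max K (M.toFun (2 * R) / M.toFun t₀)), le_max_left _ _, fun t ht htR => ?_⟩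
  have hMt := (M.pos t ht).le
  rcases le_total t t₀ with h1 | h1
  · refine (hK t ht h1).trans ?_
    gcongr
    exact (le_max_left _ _).trans (le_max_right _ _)
  · have h2 : M.toFun t₀ ≤ M.toFun t := M.mono_of_nonneg ht₀.le h1
    have h3 : M.toFun (2 * t) ≤ M.toFun (2 * R) := M.mono_of_nonneg (by positivity) (by gcongr)
    have h4 : 0 ≤ M.toFun (2 * R) := (M.nonneg (by positivity)).trans h3
    calc M.toFun (2 * t) ≤ M.toFun (2 * R) := h3
      _ = M.toFun (2 * R) / M.toFun t₀ * M.toFun t₀ := by field_simp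
      _ ≤ M.toFun (2 * R) / M.toFun t₀ * M.toFun t := by gcongr
      _ ≤ _ := by
        gcongr
        exact (le_max_right _ _).trans (le_max_right _ _)

/-- Iterate the doubling inequality along `2 ^ j ≤ v < 2 ^ (j + 1)`. Doubling is applied only at
points `2 ^ i t ≤ v t ≤ R`, where its constant is uniform. -/
theorem DeltaTwoAtZero.exists_pow_le (h : M.DeltaTwoAtZero) (R : ℝ) :
    ∃ (C : ℝ) (q : ℕ), 0 < C ∧ 1 ≤ q ∧ ∀ t v, 0 < t → 1 ≤ v → v * t ≤ R →
      M.toFun (v * t) ≤ C * v ^ q * M.toFun t := by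
  obtain ⟨K, hK1, hK⟩ := h.exists_le R
  obtain ⟨q, hq⟩ := pow_unbounded_of_one_lt K one_lt_two
  have hq' : K ≤ 2 ^ (q + 1) := hq.le.trans (pow_le_pow_right₀ one_le_two (Nat.le_succ q))
  refine ⟨K, q + 1, by positivity, by omega, fun t v ht hv hvt => ?_⟩
  obtain ⟨j, hj, hj'⟩ := exists_nat_pow_near hv one_lt_two
  have hMt := M.pos t ht
  have hiter : ∀ i : ℕ, 2 ^ i ≤ v → M.toFun (2 ^ i * (2 * t)) ≤ K ^ (i + 1) * M.toFun t := by
    intro i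
    induction i with
    | zero =>
      intro h0
      simpa using hK t ht (by nlinarith)
    | succ i ih =>
      intro hi
      have hi' : (2 : ℝ) ^ i ≤ v := (pow_le_pow_right₀ one_le_two (Nat.le_succ i)).trans hi
      have h1 := hK (2 ^ i * (2 * t)) (by positivity) (by
        refine le_trans (le_of_eq (by ring)) ((mul_le_mul_of_nonneg_right hi ht.le).trans hvt))
      calc M.toFun (2 ^ (i + 1) * (2 * t)) = M.toFun (2 * (2 ^ i * (2 * t))) := by ring_nf
        _ ≤ K * M.toFun (2 ^ i * (2 * t)) := h1
        _ ≤ K * (K ^ (i + 1) * M.toFun t) := by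
          gcongr
          exact ih hi'
        _ = _ := by ring
  calc M.toFun (v * t) ≤ M.toFun (2 ^ j * (2 * t)) := by
        refine M.mono_of_nonneg (by positivity) ?_
        rw [← mul_assoc, ← pow_succ]
        gcongr
    _ ≤ K ^ (j + 1) * M.toFun t := hiter j hj
    _ ≤ K * v ^ (q + 1) * M.toFun t := by
        gcongr
        rw [pow_succ, mul_comm]
        gcongr
        calc K ^ j ≤ (2 ^ (q + 1)) ^ j := by gcongr
          _ = (2 ^ j) ^ (q + 1) := by rw [← pow_mul, ← pow_mul, mul_comm]
          _ ≤ v ^ (q + 1) := by gcongr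

end OrliczFunction

/-! ### Completeness of `ℓ_M`, its unit vector basis and the flat estimate -/

namespace OrliczSpace

open Filter Topology

variable {𝕜 : Type*} [RCLike 𝕜] {M : OrliczFunction}

/-- The infimum in the Luxemburg norm is attained. -/
theorem norm_le_iff {x : OrliczSpace 𝕜 M} {ρ : ℝ} (hρ : 0 < ρ) :
    ‖x‖ ≤ ρ ↔ M.Admissible (coords x) ρ := by
  refine ⟨fun h => (M.admissible_iff _ _).2 ⟨hρ, fun s => ?_⟩, norm_le⟩
  have ht : Tendsto (fun r => ∑ i ∈ s, M.toFun (‖coords x i‖ / r)) (𝓝[>] ρ)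
      (𝓝 (∑ i ∈ s, M.toFun (‖coords x i‖ / ρ))) := by
    refine tendsto_finsetSum _ fun i _ => M.tendsto_comp (by positivity) ?_ ?_
    · exact (tendsto_const_nhds.div tendsto_id hρ.ne').mono_left nhdsWithin_le_nhds
    · filter_upwards [self_mem_nhdsWithin] with r hr
      exact div_nonneg (norm_nonneg _) (hρ.trans hr).le
  refine le_of_tendsto ht ?_
  filter_upwards [self_mem_nhdsWithin] with r hr
  obtain ⟨a, ha, har⟩ := exists_lt (h.trans_lt hr)
  exact ((M.admissible_iff _ _).1 (ha.of_le har.le)).2 s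

theorem exists_norm_coord_le (𝕜 : Type*) [RCLike 𝕜] (M : OrliczFunction) :
    ∃ T : ℝ, 0 < T ∧ ∀ (x : OrliczSpace 𝕜 M) i, ‖coords x i‖ ≤ T * ‖x‖ := by
  obtain ⟨T, hT, hMT⟩ := M.exists_one_lt
  refine ⟨T, hT, fun x i => ?_⟩
  rcases eq_or_ne x 0 with rfl | hx
  · simp
  have hx' : 0 < ‖x‖ := norm_pos_iff.2 hx
  have h := ((M.admissible_iff _ _).1 ((norm_le_iff hx').1 le_rfl)).2 {i}
  rw [Finset.sum_singleton] at h
  by_contra! hlt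
  rw [← lt_div_iff₀ hx'] at hlt
  have := M.mono_of_nonneg hT.le hlt.le
  linarith

/-- The coordinate functionals. -/
def coord (𝕜 : Type*) [RCLike 𝕜] (M : OrliczFunction) (i : ℕ) : StrongDual 𝕜 (OrliczSpace 𝕜 M) :=
  ((LinearMap.proj i).comp coords).mkContinuous (exists_norm_coord_le 𝕜 M).choose
    fun x => (exists_norm_coord_le 𝕜 M).choose_spec.2 x i

theorem coord_apply (x : OrliczSpace 𝕜 M) (i : ℕ) : coord 𝕜 M i x = coords x i := rfl

instance : CompleteSpace (OrliczSpace 𝕜 M) := by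
  refine Metric.complete_of_cauchySeq_tendsto fun u hu => ?_
  have hcoord : ∀ i, ∃ y, Tendsto (fun n => coords (u n) i) atTop (𝓝 y) := fun i =>
    cauchySeq_tendsto_of_complete (hu.map (coord 𝕜 M i).uniformContinuous)
  choose y hy using hcoord
  have key : ∀ ε > 0, ∃ N, ∀ m ≥ N, M.Admissible (coords (u m) - y) ε := by
    intro ε hε
    obtain ⟨N, hN⟩ := Metric.cauchySeq_iff.1 hu ε hε
    refine ⟨N, fun m hm => (M.admissible_iff _ _).2 ⟨hε, fun s => ?_⟩⟩
    have ht : Tendsto (fun n => ∑ i ∈ s, M.toFun (‖(coords (u m) - coords (u n)) i‖ / ε)) atTop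
        (𝓝 (∑ i ∈ s, M.toFun (‖(coords (u m) - y) i‖ / ε))) := by
      refine tendsto_finsetSum _ fun i _ => M.tendsto_comp (by positivity) ?_
        (Eventually.of_forall fun n => by positivity)
      exact ((tendsto_const_nhds.sub (hy i)).norm).div_const _
    refine le_of_tendsto ht ?_
    filter_upwards [eventually_ge_atTop N] with n hn
    have h1 := (hN m hm n hn).le
    rw [dist_eq_norm, norm_le_iff hε, map_sub] at h1
    exact ((M.admissible_iff _ _).1 h1).2 s
  obtain ⟨N, hN⟩ := key 1 one_pos
  have hmem : y ∈ M.submodule 𝕜 := by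
    have h1 : coords (u N) - y ∈ M.submodule 𝕜 := ⟨1, (hN N le_rfl).1, (hN N le_rfl).2.1⟩
    have h2 := (M.submodule 𝕜).sub_mem (show coords (u N) ∈ M.submodule 𝕜 from (u N).2) h1
    rwa [sub_sub_cancel] at h2
  let z : OrliczSpace 𝕜 M := ⟨y, hmem⟩
  refine ⟨z, Metric.tendsto_atTop.2 fun ε hε => ?_⟩
  obtain ⟨N, hN⟩ := key (ε / 2) (by positivity)
  refine ⟨N, fun m hm => ?_⟩
  have h2 : ‖u m - z‖ ≤ ε / 2 := (norm_le_iff (by positivity)).2 (by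
    rw [map_sub]
    exact hN m hm)
  rw [dist_eq_norm]
  linarith

/-- The coordinates of `x` are bounded, so `Δ₂` on a bounded interval lets the scale be halved
repeatedly. Summability at every scale is what makes the unit vector expansion converge. -/
theorem summable_of_deltaTwo (hM : M.DeltaTwoAtZero) (x : OrliczSpace 𝕜 M) {ρ : ℝ} (hρ : 0 < ρ) :
    Summable fun i => M.toFun (‖coords x i‖ / ρ) := by
  obtain ⟨T, hT, hTx⟩ := exists_norm_coord_le 𝕜 M
  have hhalf : ∀ r, 0 < r → (Summable fun i => M.toFun (‖coords x i‖ / r)) →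
      Summable fun i => M.toFun (‖coords x i‖ / (r / 2)) := by
    intro r hr h
    obtain ⟨K, hK1, hK⟩ := hM.exists_le (T * ‖x‖ / r)
    refine Summable.of_nonneg_of_le (fun i => M.nonneg (by positivity)) (fun i => ?_)
      (h.mul_left K)
    rcases eq_or_ne (coords x i) 0 with h0 | h0
    · simp [h0, M.map_zero]
    · have h1 := hK (‖coords x i‖ / r) (by positivity) (by
        gcongr
        exact hTx x i)
      rwa [show ‖coords x i‖ / (r / 2) = 2 * (‖coords x i‖ / r) by field_simp]
  obtain ⟨r, hr, hsum⟩ := x.2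
  have hpow : ∀ j : ℕ, Summable fun i => M.toFun (‖coords x i‖ / (r / 2 ^ j)) := by
    intro j
    induction j with
    | zero =>
      rw [pow_zero, div_one]
      exact hsum
    | succ j ih =>
      have := hhalf _ (by positivity) ih
      rwa [div_div, ← pow_succ] at this
  obtain ⟨j, hj⟩ := pow_unbounded_of_one_lt (r / ρ) one_lt_two
  refine Summable.of_nonneg_of_le (fun i => M.nonneg (by positivity)) (fun i => ?_) (hpow j)
  refine M.mono_of_nonneg (by positivity) ?_
  gcongr
  rw [div_lt_iff₀ hρ] at hj
  rw [div_le_iff₀ (by positivity)]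
  linarith

theorem coords_unitVector (i : ℕ) : coords (unitVector 𝕜 M i) = Pi.single i 1 := rfl

theorem coords_sum_unitVector (s : Finset ℕ) (a : ℕ → 𝕜) (j : ℕ) :
    coords (∑ i ∈ s, a i • unitVector 𝕜 M i) j = if j ∈ s then a j else 0 := by
  simp [coords_unitVector, Finset.sum_apply, Pi.single_apply]

theorem hasSum_unitVector (hM : M.DeltaTwoAtZero) (x : OrliczSpace 𝕜 M) :
    HasSum (fun i => coord 𝕜 M i x • unitVector 𝕜 M i) x := by
  rw [HasSum, SummationFilter.unconditional_filter, Metric.tendsto_atTop]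
  intro ε hε
  obtain ⟨s, hs⟩ := summable_iff_vanishing_norm.1
    (summable_of_deltaTwo hM x (half_pos hε)) 1 one_pos
  refine ⟨s, fun t hst => ?_⟩
  rw [dist_comm, dist_eq_norm]
  refine lt_of_le_of_lt ((norm_le_iff (half_pos hε)).2 ?_) (half_lt_self hε)
  refine (M.admissible_iff _ _).2 ⟨half_pos hε, fun S => ?_⟩
  have h1 : ∀ i, M.toFun (‖coords (x - ∑ i ∈ t, coord 𝕜 M i x • unitVector 𝕜 M i) i‖ / (ε / 2)) =
      if i ∈ t then 0 else M.toFun (‖coords x i‖ / (ε / 2)) := fun i => by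
    rw [map_sub, Pi.sub_apply, coords_sum_unitVector, coord_apply]
    split_ifs <;> simp [M.map_zero]
  simp only [h1, ← ite_not (_ ∈ t)]
  rw [← Finset.sum_filter, Finset.filter_notMem_eq_sdiff]
  have h2 := hs (S \ t) (Finset.disjoint_of_subset_right hst Finset.sdiff_disjoint)
  exact (le_abs_self _).trans h2.le

/-- The unit vectors form a Schauder basis of `ℓ_M` if `M` satisfies the `Δ₂` condition at zero. -/
def unitBasis (𝕜 : Type*) [RCLike 𝕜] {M : OrliczFunction} (hM : M.DeltaTwoAtZero) :
    SchauderBasis 𝕜 (OrliczSpace 𝕜 M) where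
  basis := unitVector 𝕜 M
  coord := coord 𝕜 M
  ortho i j := by
    rw [coord_apply, coords_unitVector]
    simp [Pi.single_apply]
  expansion x := (hasSum_unitVector hM x).mono_left SummationFilter.le_atTop

open IsOneSymmetric

variable {ι : Type*} [Fintype ι]

theorem norm_blockSum_le_iff (hM : M.DeltaTwoAtZero) {ψ : ι → ℕ} (hψ : Function.Injective ψ)
    (a : ι → 𝕜) {ρ : ℝ} (hρ : 0 < ρ) :
    ‖blockSum (unitBasis 𝕜 hM) ψ a‖ ≤ ρ ↔ ∑ i, M.toFun (‖a i‖ / ρ) ≤ 1 := by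
  have h1 : ∀ i, coords (blockSum (unitBasis 𝕜 hM) ψ a) (ψ i) = a i :=
    coord_blockSum (e := unitBasis 𝕜 hM) hψ a
  have h2 : HasSum (fun j => M.toFun (‖coords (blockSum (unitBasis 𝕜 hM) ψ a) j‖ / ρ))
      (∑ i, M.toFun (‖a i‖ / ρ)) := by
    rw [← hψ.hasSum_iff]
    · convert hasSum_fintype _ using 2 with i
      simp [h1]
    · intro j hj
      have : coords (blockSum (unitBasis 𝕜 hM) ψ a) j = 0 := by
        simp only [blockSum, map_sum, map_smul, Finset.sum_apply]
        refine Finset.sum_eq_zero fun i _ => ?_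
        have hji : j ≠ ψ i := fun h => hj ⟨i, h.symm⟩
        change a i • (Pi.single (ψ i) (1 : 𝕜) : ℕ → 𝕜) j = 0
        simp [hji]
      simp [this, M.map_zero]
  rw [norm_le_iff hρ]
  refine ⟨fun h => h2.tsum_eq ▸ h.2.2, fun h => ⟨hρ, h2.summable, h2.tsum_eq.symm ▸ h⟩⟩

theorem isOneSymmetric_unitBasis (hM : M.DeltaTwoAtZero) : IsOneSymmetric (unitBasis 𝕜 hM) := by
  intro s a θ π
  have h1 : ∑ i ∈ s, (θ i : ℤ) • a i • (unitBasis 𝕜 hM).basis (π i) =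
      blockSum (unitBasis 𝕜 hM) (fun i : s => π i) (fun i => ((θ i : ℤ) : 𝕜) * a i) := by
    rw [← Finset.sum_coe_sort]
    simp [blockSum, mul_smul, Int.cast_smul_eq_zsmul]
  have h2 : ∑ i ∈ s, a i • (unitBasis 𝕜 hM).basis i =
      blockSum (unitBasis 𝕜 hM) (fun i : s => i) (fun i => a i) := by
    rw [← Finset.sum_coe_sort]
    rfl
  have hiff : ∀ ρ, 0 < ρ →
      (‖∑ i ∈ s, (θ i : ℤ) • a i • (unitBasis 𝕜 hM).basis (π i)‖ ≤ ρ ↔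
        ‖∑ i ∈ s, a i • (unitBasis 𝕜 hM).basis i‖ ≤ ρ) := by
    intro ρ hρ
    rw [h1, h2, norm_blockSum_le_iff hM (ψ := fun i : s => π i) (π.injective.comp Subtype.val_injective) _ hρ,
      norm_blockSum_le_iff hM Subtype.val_injective _ hρ]
    have : ∀ i, ‖((θ i : ℤ) : 𝕜) * a i‖ = ‖a i‖ := fun i => by
      rcases Int.units_eq_one_or (θ i) with h | h <;> simp [h]
    simp only [this]
  refine le_antisymm (le_of_forall_pos_le_add fun ε hε => ?_)
    (le_of_forall_pos_le_add fun ε hε => ?_)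
  · exact (hiff _ (by positivity)).2 (by linarith)
  · exact (hiff _ (by positivity)).1 (by linarith)

/-- With `t = 1 / λ(n)` one has `n M(t) ≤ 1`. Convexity for `w ≤ 1` and polynomial growth for `w ≥
1` give `M(w t) ≤ (w + C w ^ q) M(t)`, so the modular of `y` is controlled by its first and `q`-th
moments. -/
theorem flatBound_unitBasis (hM : M.DeltaTwoAtZero) : FlatBound (unitBasis 𝕜 hM) := by
  have he := isOneSymmetric_unitBasis (𝕜 := 𝕜) hM
  -- `R = 1 / λ(1)` is the largest value of `t = 1 / λ(n)`, so the growth of `M` is needed only on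
  -- `(0, R]`.
  have hlam1 := he.fundamental_pos one_pos
  set R := (fundamental (unitBasis 𝕜 hM) 1)⁻¹ with hR
  have hR0 : 0 < R := inv_pos.2 hlam1
  have hMR := M.pos R hR0
  obtain ⟨C, q, hC0, hq1, hC⟩ := hM.exists_pow_le R
  set D := C * (16 * q.factorial) with hD
  have hD0 : 0 < D := by positivity
  -- The first two summands make the first and `q`-th moment terms at most `1 / 2` each; the third
  -- gives `D / B ^ q < M(R)`, which excludes `w i * t > R`.
  set B := 32 + 2 * D + 2 * D / M.toFun R with hB
  have hB1 : 32 ≤ B := by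
    have : 0 < 2 * D / M.toFun R := by positivity
    linarith
  have hB0 : 0 < B := by linarith
  have hBq : B ≤ B ^ q := le_self_pow₀ (by linarith) (by omega)
  have hDB : D / B ^ q ≤ 1 / 2 := by
    rw [div_le_iff₀ (by positivity)]
    have : 0 < 2 * D / M.toFun R := by positivity
    linarith
  have hDB' : D / B ^ q < M.toFun R := by
    rw [div_lt_iff₀ (by positivity)]
    have h1 : M.toFun R * (2 * D / M.toFun R) = 2 * D := by field_simp
    have h2 : M.toFun R * (2 * D / M.toFun R) ≤ M.toFun R * B ^ q := by
      gcongr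
      linarith
    linarith
  refine ⟨B, hB0, fun n y s hs hy => ?_⟩
  rcases Nat.eq_zero_or_pos n with rfl | hn
  · simp [blockSum, fundamental]
  have hn0 : (0 : ℝ) < n := by exact_mod_cast hn
  have hlam := he.fundamental_pos hn
  set t := (fundamental (unitBasis 𝕜 hM) n)⁻¹ with ht
  have ht0 : 0 < t := inv_pos.2 hlam
  have htR : t ≤ R := inv_anti₀ hlam1 (he.fundamental_mono hn)
  have hMt : n * M.toFun t ≤ 1 := by
    have h1 : ‖blockSum (unitBasis 𝕜 hM) (fun i : Fin n => (i : ℕ)) 1‖ ≤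
      fundamental (unitBasis 𝕜 hM) n := le_rfl
    rw [norm_blockSum_le_iff hM Fin.val_injective _ hlam] at h1
    simpa [ht] using h1
  have hMt0 := M.pos t ht0
  rw [norm_blockSum_le_iff hM Fin.val_injective _ (by positivity)]
  have hpow := sum_pow_le_of_sum_exp_le (y := y) hs (by simpa using hy)
  set w : Fin n → ℝ := fun i => ‖y i‖ / s / B with hw
  have hw0 : ∀ i, 0 ≤ w i := fun i => by positivity
  have hwpow : ∀ N : ℕ, ∑ i, w i ^ N ≤ 16 * N.factorial * n / B ^ N := fun N => by
    have h1 := hpow N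
    simp only [hw, div_pow]
    rw [← Finset.sum_div, ← Finset.sum_div]
    gcongr
    rw [div_le_iff₀ (by positivity)]
    simpa using h1
  -- no coefficient leaves the range where the growth of `M` is controlled
  have hwR : ∀ i, w i * t ≤ R := by
    intro i
    by_contra! hlt
    have h1 : 1 ≤ R / t := (one_le_div ht0).2 htR
    -- The growth estimate is used at the endpoint `R`, since it is not available at `w i * t`
    -- itself.
    have h2 := hC t (R / t) ht0 h1 (by field_simp; exact le_rfl)
    rw [div_mul_cancel₀ _ ht0.ne'] at h2
    have h3 : R / t ≤ w i := (div_le_iff₀ ht0).2 hlt.le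
    have h4 : w i ^ q ≤ 16 * q.factorial * n / B ^ q :=
      (Finset.single_le_sum (f := fun i => w i ^ q) (fun i _ => pow_nonneg (hw0 i) q)
        (Finset.mem_univ i)).trans (hwpow q)
    have h5 : M.toFun R ≤ D / B ^ q := by
      calc M.toFun R ≤ C * (R / t) ^ q * M.toFun t := h2
        _ ≤ C * (16 * q.factorial * n / B ^ q) * M.toFun t := by
            gcongr
            exact (pow_le_pow_left₀ (by positivity) h3 q).trans h4
        _ = D / B ^ q * (n * M.toFun t) := by rw [hD]; ring
        _ ≤ D / B ^ q * 1 := by gcongr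
        _ = _ := mul_one _
    linarith
  have hpt : ∀ i, M.toFun (‖y i‖ / (B * s * fundamental (unitBasis 𝕜 hM) n)) ≤
      (w i + C * w i ^ q) * M.toFun t := by
    intro i
    have h1 : ‖y i‖ / (B * s * fundamental (unitBasis 𝕜 hM) n) = w i * t := by
      rw [hw, ht]
      field_simp
    rw [h1]
    have h0 := hw0 i
    rcases le_total (w i) 1 with h2 | h2
    · refine (M.scale_le ht0.le h0 h2).trans ?_
      gcongr
      exact le_add_of_nonneg_right (by positivity)
    · refine (hC t (w i) ht0 h2 (hwR i)).trans ?_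
      gcongr
      exact le_add_of_nonneg_left h0
  refine (Finset.sum_le_sum fun i _ => hpt i).trans ?_
  rw [← Finset.sum_mul, Finset.sum_add_distrib, ← Finset.mul_sum]
  have h1 := hwpow 1
  have h2 := hwpow q
  simp only [pow_one, Nat.factorial_one, Nat.cast_one, mul_one] at h1
  have h3 : 16 / B ≤ 1 / 2 := by
    rw [div_le_iff₀ hB0]
    linarith
  calc (∑ i, w i + C * ∑ i, w i ^ q) * M.toFun t
      ≤ (16 * n / B + C * (16 * q.factorial * n / B ^ q)) * M.toFun t := by gcongr
    _ = (16 / B + D / B ^ q) * (n * M.toFun t) := by rw [hD]; ring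
    _ ≤ 1 * 1 := by
        gcongr
        linarith
    _ = 1 := one_mul 1

theorem isEquivalentToHilbertBasis_unitBasis (hM : M.DeltaTwoAtZero)
    (h : HasUnconditionalCharacterBlocks (unitBasis 𝕜 hM)) :
    IsEquivalentToHilbertBasis (unitBasis 𝕜 hM) :=
  (isOneSymmetric_unitBasis hM).isEquivalentToHilbertBasis_of_flatBound (flatBound_unitBasis hM) h

end OrliczSpace

end

end

/-! ### The main theorem -/

theorem mainTheorem8 :
    -- real or complex Banach spaces
    (∀ (𝕜 : Type u) [RCLike 𝕜] (X : Type v) [NormedAddCommGroup X] [NormedSpace 𝕜 X]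
      [CompleteSpace X] (e : SchauderBasis 𝕜 X), IsOneSymmetric e →
      (HasTypeTwo X ∨ HasCotypeTwo X) → ¬ IsIsomorphicToHilbert 𝕜 X →
      ∃ x : ℕ → X, IsNonUnconditionalAuerbach 𝕜 x) ∧
    -- complex Banach spaces: characters on cyclic blocks
    (∀ (X : Type v) [NormedAddCommGroup X] [NormedSpace ℂ X] [CompleteSpace X]
      (e : SchauderBasis ℂ X), IsOneSymmetric e →
      (HasTypeTwo X ∨ HasCotypeTwo X) → ¬ IsIsomorphicToHilbert ℂ X →
      ∀ n : ℕ → ℕ, StrictMono n → 0 < n 0 →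
        IsNonUnconditionalAuerbach ℂ (characterSystem e.basis n)) ∧
    -- real or complex Orlicz sequence spaces
    (∀ (𝕜 : Type u) [RCLike 𝕜] (M : OrliczFunction), M.DeltaTwoAtZero →
      (2 ≤ M.lowerIndex ∨ M.upperIndex ≤ 2) →
      ¬ IsIsomorphicToHilbert 𝕜 (OrliczSpace 𝕜 M) →
      ∃ x : ℕ → OrliczSpace 𝕜 M, IsNonUnconditionalAuerbach 𝕜 x) ∧
    -- complex Orlicz sequence spaces: characters on cyclic blocks
    (∀ M : OrliczFunction, M.DeltaTwoAtZero → (2 ≤ M.lowerIndex ∨ M.upperIndex ≤ 2) →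
      ¬ IsIsomorphicToHilbert ℂ (OrliczSpace ℂ M) →
      ∀ n : ℕ → ℕ, StrictMono n → 0 < n 0 →
        IsNonUnconditionalAuerbach ℂ (characterSystem (OrliczSpace.unitVector ℂ M) n)) := by
  refine ⟨fun 𝕜 _ X _ _ _ e he htype hX => ?_, fun X _ _ _ e he htype hX n hn hn0 => ?_,
    fun 𝕜 _ M hM _ hX => ?_, fun M hM _ hX n hn hn0 => ?_⟩
  · exact he.exists_isNonUnconditionalAuerbach
      (he.hasUnconditionalCharacterBlocks_imp htype) hX
  · exact he.isNonUnconditionalAuerbach_characterSystem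
      (he.hasUnconditionalCharacterBlocks_imp htype) hX hn hn0
  · exact (OrliczSpace.isOneSymmetric_unitBasis hM).exists_isNonUnconditionalAuerbach
      (OrliczSpace.isEquivalentToHilbertBasis_unitBasis hM) hX
  · exact (OrliczSpace.isOneSymmetric_unitBasis hM).isNonUnconditionalAuerbach_characterSystem
      (OrliczSpace.isEquivalentToHilbertBasis_unitBasis hM) hX hn hn0
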